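/- **Gel'fand natural isomorphism.** *Commutative C\*-categories.* A small C\*-category $\mathcal C$ has objects $\mathcal C^0$ and complex Banach spaces $\mathcal C_{AB}=\mathrm{Hom}(B;A)$, with bilinear associative composition $\mathcal C_{AB}\times\mathcal C_{BC}\to\mathcal C_{AC}$, identities $\iota_A$ and a conjugate-linear involution ${}^*:\mathcal C_{AB}\to\mathcal C_{BA}$, $(xy)^*=y^*x^*$, such that $\|xy\|\le\|x\|\,\|y\|$, $\|x^*x\|=\|x\|^2$, and $x^*x$ is positive in $\mathcal C_{BB}$ for $x\in\mathcal C_{AB}$. It is commutative if all algebras $\mathcal C_{AA}$ are commutative; fullness is not assumed. Let $[\mathcal C;\mathbb C]$ be the set of all maps $\omega$ from the morphisms of $\mathcal C$ to $\mathbb C$ that are linear on each $\mathcal C_{AB}$, multiplicative on composable pairs and satisfy $\omega(x^*)=\overline{\omega(x)}$, with the topology of pointwise convergence ($\omega(\iota_A)=0$ is allowed). Let $\mathscr A$ be the category whose objects are the small commutative C\*-categories and whose morphisms are the \*-functors $\phi:\mathcal C\to\mathcal D$, linear on Hom-sets, which are bijective on objects and non-degenerate: if $\omega\in[\mathcal D;\mathbb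 C]$ is not zero on $\mathcal D_{\phi(A)\phi(B)}$, then $\omega\circ\phi$ is not zero on $\mathcal C_{AB}$. *Non-full spaceoids.* A non-full spaceoid over a set $\mathcal O$ consists of - a topological groupoid $\mathcal X=\biguplus_{A,B\in\mathcal O}\mathcal X_{AB}$ (disjoint union topology) with $\mathcal X_{AB}\circ\mathcal X_{BC}\subseteq\mathcal X_{AC}$ and $\mathcal X_{AB}^{-1}=\mathcal X_{BA}$, such that every $\mathcal X_{AA}$ is compact Hausdorff and consists of identities, and the target and source maps $\mathcal X_{AB}\to\mathcal X_{AA}$, $\mathcal X_{AB}\to\mathcal X_{BB}$ are homeomorphisms onto open subsets; - a saturated (there is a continuous section through every point) Banach line bundle $\mathcal E\to\mathcal X$ of Fell type, which is a unital Fell bundle over $\mathcal X$: it has a continuous associative bilinear composition $\mathcal E_p\times\mathcal E_q\to\mathcal E_{p\circ q}$, a continuous conjugate-linear involution $\mathcal E_p\to\mathcal E_{p^{-1}}$ and continuous units $\iota_p\in\mathcal E_p$ for $p\in\mathcal X_{AA}$, with $\|ef\|\le\|e\|\|f\|$, $\|e^*e\|=\|e\|^2$ and $e^*e$ positive. A morphism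 $(f,F):\mathcal E^1\to\mathcal E^2$ consists of a bijection $\mathcal O^1\to\mathcal O^2$, a continuous \*-functor $f:\mathcal X^1\to\mathcal X^2$ over it such that for every compact $K\subseteq\mathcal X^2_{f(A)f(B)}$ there is a compact $L\subseteq\mathcal X^1_{AB}$ with $f(\mathcal X^1_{AB}\setminus L)\cap K=\emptyset$, and a continuous fibrewise linear \*-functor $F:f^\bullet(\mathcal E^2)\to\mathcal E^1$ over the identity of $\mathcal X^1$ such that for all $\epsilon>0$ and compact $K\subseteq\mathcal X^1_{AB}$ there are $\delta>0$ and a compact $L\subseteq\mathcal X^1_{AB}$ such that, for $p\notin L$ and $\|e\|<\delta$ with $e\in\mathcal E^2_{f(p)}$, one has $p\notin K$ and $\|F_p(e)\|<\epsilon$. *Sections.* For a non-full spaceoid $\mathcal E$, $\Gamma(\mathcal E)$ has objects $\mathcal O$; $\Gamma(\mathcal E)_{AB}$ is the space of continuous sections of $\mathcal E$ over $\mathcal X_{AB}$ vanishing at infinity, with norm $\|\sigma\|=\sup_p\|\sigma(p)\|$ (equal to $0$ if $\mathcal X_{AB}=\emptyset$), composition $(\sigma\circ\rho)(p\circ q)=\sigma(p)\rho(q)$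 for $p\in\mathcal X_{AB}$, $q\in\mathcal X_{BC}$ and $(\sigma\circ\rho)(r)=0$ if $r$ is not of the form $p\circ q$, involution $\sigma^*(p^{-1})=\sigma(p)^*$, and identities $p\mapsto\iota_p$. For $(f,F):\mathcal E^1\to\mathcal E^2$ the functor $\Gamma_{(f,F)}:\Gamma(\mathcal E^2)\to\Gamma(\mathcal E^1)$ is $\Gamma_{(f,F)}(\sigma)(p)=F_p(\sigma(f(p)))$. *The spectrum.* For $\mathcal C\in\mathscr A$ and $A,B\in\mathcal C^0$, write $[\omega]_{AB}=[\rho]_{AB}$ if $\rho|_{\mathcal C_{AB}}=u\,\omega|_{\mathcal C_{AB}}$ for some $u\in\mathbb C$ with $|u|=1$, and $\ker(\omega)_{AB}=\{x\in\mathcal C_{AB}:\omega(x)=0\}$. Give the set of all classes $[\omega]_{AB}$ the quotient topology of $[\mathcal C;\mathbb C]$, and let $\mathcal X^{\mathcal C}_{AB}$ be its subspace of the classes with $\dim \mathcal C_{AB}/\ker(\omega)_{AB}=1$. Let $\Sigma(\mathcal C)$ be given by these spaces, with $[\omega]_{AB}\mapsto[\omega]_{AA}$ and $[\omega]_{AB}\mapsto[\omega]_{BB}$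 as target and source, $[\omega]_{AB}\circ[\omega]_{BC}=[\omega]_{AC}$, $[\omega]_{AB}^{-1}=[\omega]_{BA}$; the fibers $\mathcal C_{AB}/\ker(\omega)_{AB}$ with the quotient norm, $(x+\ker(\omega)_{AB})(y+\ker(\omega)_{BC})=xy+\ker(\omega)_{AC}$, $(x+\ker(\omega)_{AB})^*=x^*+\ker(\omega)_{BA}$ and units $\iota_A+\ker(\omega)_{AA}$; and the tubular topology on the total space, generated by the sets $\{e:\pi(e)\in O,\ \|e-\hat x(\pi(e))\|<\epsilon\}$, for $x\in\mathcal C_{AB}$, $O\subseteq\mathcal X^{\mathcal C}_{AB}$ open and $\epsilon>0$, where $\hat x([\omega]_{AB})=x+\ker(\omega)_{AB}$. For $\phi:\mathcal C\to\mathcal D$ in $\mathscr A$, let $\Sigma_\phi=(\lambda^\phi,\Lambda^\phi)$ be given by the inverse of $\phi$ on objects, $\lambda^\phi([\omega]_{\phi(A)\phi(B)})=[\omega\circ\phi]_{AB}$ and $\Lambda^\phi(x+\ker(\omega\circ\phi)_{AB})=\phi(x)+\ker(\omega)_{\phi(A)\phi(B)}$. **Theorem.** For every small commutative, not necessarily full,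 C\*-category $\mathcal C$, $\Sigma(\mathcal C)$ is a non-full spaceoid, the operations of $\Gamma(\Sigma(\mathcal C))$ are well defined and make it a small commutative C\*-category; for every morphism $\phi:\mathcal C\to\mathcal D$ of $\mathscr A$, $\Sigma_\phi:\Sigma(\mathcal D)\to\Sigma(\mathcal C)$ is a morphism of spaceoids and $\Gamma_{\Sigma_\phi}:\Gamma(\Sigma(\mathcal C))\to\Gamma(\Sigma(\mathcal D))$ is a morphism of $\mathscr A$; and $\mathcal C\mapsto\Gamma(\Sigma(\mathcal C))$, $\phi\mapsto\Gamma_{\Sigma_\phi}$ is a functor $\mathscr A\to\mathscr A$. Every $\hat x$ is a continuous section vanishing at infinity, and the Gel'fand transform $\mathfrak G_{\mathcal C}:\mathcal C\to\Gamma(\Sigma(\mathcal C))$, $A\mapsto A$, $x\mapsto\hat x$, is a morphism of $\mathscr A$ which maps every $\mathcal C_{AB}$ isometrically and bijectively onto $\Gamma(\Sigma(\mathcal C))_{AB}$. These maps are the components of a natural isomorphism $\mathfrak G:\mathrm{Id}_{\mathscr A}\cong\Gamma\circ\Sigma$ in $\mathscr A$. -/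

import Mathlib

open CategoryTheory Topology

universe u

noncomputable section

/-! ### Commutative C*-categories and the category of non-degenerate `*`-functors -/

/-- The data of a small normed involutive complex algebroid.
`Hom A B` is the Hom-set `𝒞_{AB} = Hom(B; A)` of morphisms with source `B` and target `A`. -/
structure CStarCatData where
  Obj : Type u
  Hom : Obj → Obj → Type u
  [normedAddCommGroup : ∀ A B, NormedAddCommGroup (Hom A B)]
  [normedSpace : ∀ A B, NormedSpace ℂ (Hom A B)]
  one : ∀ A, Hom A A
  comp : ∀ {A B C}, Hom A B → Hom B C → Hom A C
  star : ∀ {A B}, Hom A B → Hom B A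

attribute [instance] CStarCatData.normedAddCommGroup CStarCatData.normedSpace

/-- The axioms of a commutative C*-category. No fullness is required.
Positivity of `x* ∘ x` in the C*-algebra `𝒞_{BB}` is expressed as `x* ∘ x = y* ∘ y` for some
`y ∈ 𝒞_{BB}`. -/
structure CStarCatData.IsCommCStarCat (𝒞 : CStarCatData.{u}) : Prop where
  complete : ∀ A B, CompleteSpace (𝒞.Hom A B)
  comp_assoc : ∀ {A B C D} (x : 𝒞.Hom A B) (y : 𝒞.Hom B C) (z : 𝒞.Hom C D),
    𝒞.comp (𝒞.comp x y) z = 𝒞.comp x (𝒞.comp y z)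
  one_comp : ∀ {A B} (x : 𝒞.Hom A B), 𝒞.comp (𝒞.one A) x = x
  comp_one : ∀ {A B} (x : 𝒞.Hom A B), 𝒞.comp x (𝒞.one B) = x
  add_comp : ∀ {A B C} (x x' : 𝒞.Hom A B) (y : 𝒞.Hom B C),
    𝒞.comp (x + x') y = 𝒞.comp x y + 𝒞.comp x' y
  comp_add : ∀ {A B C} (x : 𝒞.Hom A B) (y y' : 𝒞.Hom B C),
    𝒞.comp x (y + y') = 𝒞.comp x y + 𝒞.comp x y'
  smul_comp : ∀ {A B C} (a : ℂ) (x : 𝒞.Hom A B) (y : 𝒞.Hom B C),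
    𝒞.comp (a • x) y = a • 𝒞.comp x y
  comp_smul : ∀ {A B C} (a : ℂ) (x : 𝒞.Hom A B) (y : 𝒞.Hom B C),
    𝒞.comp x (a • y) = a • 𝒞.comp x y
  star_star : ∀ {A B} (x : 𝒞.Hom A B), 𝒞.star (𝒞.star x) = x
  star_one : ∀ A, 𝒞.star (𝒞.one A) = 𝒞.one A
  star_comp : ∀ {A B C} (x : 𝒞.Hom A B) (y : 𝒞.Hom B C),
    𝒞.star (𝒞.comp x y) = 𝒞.comp (𝒞.star y) (𝒞.star x)
  star_add : ∀ {A B} (x y : 𝒞.Hom A B), 𝒞.star (x + y) = 𝒞.star x + 𝒞.star y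
  star_smul : ∀ {A B} (a : ℂ) (x : 𝒞.Hom A B),
    𝒞.star (a • x) = (starRingEnd ℂ) a • 𝒞.star x
  norm_comp_le : ∀ {A B C} (x : 𝒞.Hom A B) (y : 𝒞.Hom B C), ‖𝒞.comp x y‖ ≤ ‖x‖ * ‖y‖
  norm_star_comp_self : ∀ {A B} (x : 𝒞.Hom A B), ‖𝒞.comp (𝒞.star x) x‖ = ‖x‖ ^ 2
  star_comp_self_pos : ∀ {A B} (x : 𝒞.Hom A B),
    ∃ y : 𝒞.Hom B B, 𝒞.comp (𝒞.star x) x = 𝒞.comp (𝒞.star y) y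
  comm : ∀ {A} (x y : 𝒞.Hom A A), 𝒞.comp x y = 𝒞.comp y x

/-- A small commutative (not necessarily full) C*-category. -/
structure CommCStarCat extends CStarCatData.{u} where
  isComm : toCStarCatData.IsCommCStarCat

/-- An element of `[𝒞; ℂ]`: a `ℂ`-linear, multiplicative, involutive assignment `𝒞 → ℂ`.
It is allowed to vanish on Hom-sets, also on diagonal ones, so `ω(ι_A) ∈ {0, 1}`. -/
@[ext] structure CStarCatData.Character (𝒞 : CStarCatData.{u}) where
  app : ∀ A B, 𝒞.Hom A B →ₗ[ℂ] ℂ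
  map_comp : ∀ {A B C} (x : 𝒞.Hom A B) (y : 𝒞.Hom B C),
    app A C (𝒞.comp x y) = app A B x * app B C y
  map_star : ∀ {A B} (x : 𝒞.Hom A B), app B A (𝒞.star x) = (starRingEnd ℂ) (app A B x)

/-- The weak-`*` topology on `[𝒞; ℂ]`. -/
instance (𝒞 : CStarCatData.{u}) : TopologicalSpace 𝒞.Character :=
  TopologicalSpace.induced
    (fun ω => fun x : (Σ A, Σ B, 𝒞.Hom A B) => ω.app x.1 x.2.1 x.2.2) inferInstance

/-- The data of a functor which is linear on each Hom-set. -/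
structure CStarCatData.LinFunctor (𝒞 𝒟 : CStarCatData.{u}) where
  obj : 𝒞.Obj → 𝒟.Obj
  map : ∀ {A B}, 𝒞.Hom A B →ₗ[ℂ] 𝒟.Hom (obj A) (obj B)

/-- Object-bijective non-degenerate `*`-functors. -/
structure CStarCatData.LinFunctor.IsMorphism {𝒞 𝒟 : CStarCatData.{u}}
    (φ : 𝒞.LinFunctor 𝒟) : Prop where
  bijective : Function.Bijective φ.obj
  map_one : ∀ A, φ.map (𝒞.one A) = 𝒟.one (φ.obj A)
  map_comp : ∀ {A B C} (x : 𝒞.Hom A B) (y : 𝒞.Hom B C),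
    φ.map (𝒞.comp x y) = 𝒟.comp (φ.map x) (φ.map y)
  map_star : ∀ {A B} (x : 𝒞.Hom A B), φ.map (𝒞.star x) = 𝒟.star (φ.map x)
  nondegenerate : ∀ (ω : 𝒟.Character) (A B : 𝒞.Obj),
    (∃ y, ω.app (φ.obj A) (φ.obj B) y ≠ 0) →
      ∃ x : 𝒞.Hom A B, ω.app (φ.obj A) (φ.obj B) (φ.map x) ≠ 0

/-- The functor is isometric on each Hom-set. -/
def CStarCatData.LinFunctor.IsIsometric {𝒞 𝒟 : CStarCatData.{u}} (φ : 𝒞.LinFunctor 𝒟) : Prop :=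
  ∀ (A B : 𝒞.Obj) (x : 𝒞.Hom A B), ‖φ.map x‖ = ‖x‖

/-- A morphism of the category of small commutative C*-categories. -/
structure CommCStarCat.Mor (𝒞 𝒟 : CommCStarCat.{u}) extends
    CStarCatData.LinFunctor 𝒞.toCStarCatData 𝒟.toCStarCatData where
  isMorphism : toLinFunctor.IsMorphism

/-- The pull-back `ω ∘ φ`. -/
def CStarCatData.Character.pullback {𝒞 𝒟 : CommCStarCat.{u}} (φ : 𝒞.Mor 𝒟)
    (ω : 𝒟.Character) : 𝒞.Character where
  app A B := ω.app (φ.obj A) (φ.obj B) ∘ₗ φ.map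
  map_comp x y := by simp [φ.isMorphism.map_comp, ω.map_comp]
  map_star x := by simp [φ.isMorphism.map_star, ω.map_star]

/-- The category of small commutative C*-categories. -/
instance : Category CommCStarCat.{u} where
  Hom := CommCStarCat.Mor
  id 𝒞 :=
    { obj := id
      map := LinearMap.id
      isMorphism := ⟨Function.bijective_id, fun _ => rfl, fun _ _ => rfl, fun _ => rfl,
        fun _ _ _ h => h⟩ }
  comp {𝒞 𝒟 _} φ ψ :=
    { obj := ψ.obj ∘ φ.obj
      map := ψ.map ∘ₗ φ.map
      isMorphism :=
        ⟨ψ.isMorphism.bijective.comp φ.isMorphism.bijective,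
          fun A => by
            simp [φ.isMorphism.map_one, ψ.isMorphism.map_one],
          fun x y => by simp [φ.isMorphism.map_comp, ψ.isMorphism.map_comp],
          fun x => by simp [φ.isMorphism.map_star, ψ.isMorphism.map_star],
          fun ω A B h => φ.isMorphism.nondegenerate (ω.pullback ψ) A B
            (ψ.isMorphism.nondegenerate ω _ _ h)⟩ }

/-! ### Non-full spaceoids -/

/-- The data of a Fell bundle over a groupoid fibered over the pair groupoid of a set `Obj`.
The groupoid is given by its fibers `X A B`, its space of objects being the disjoint union of the
`X A A`; both it and the total space carry the disjoint union topology over the pairs `(A, B)`.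
For `p ∈ X A B` the target is `tgt p ∈ X A A`, the source is `src p ∈ X B B`. -/
structure SpaceoidData where
  Obj : Type u
  X : Obj → Obj → Type u
  [topX : ∀ A B, TopologicalSpace (X A B)]
  tgt : ∀ {A B}, X A B → X A A
  src : ∀ {A B}, X A B → X B B
  comp : ∀ {A B C} (p : X A B) (q : X B C), src p = tgt q → X A C
  inv : ∀ {A B}, X A B → X B A
  fib : ∀ {A B}, X A B → Type u
  [normedAddCommGroup : ∀ {A B} (p : X A B), NormedAddCommGroup (fib p)]
  [normedSpace : ∀ {A B} (p : X A B), NormedSpace ℂ (fib p)]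
  topTotal : ∀ A B, TopologicalSpace (Bundle.TotalSpace ℂ (fun p : X A B => fib p))
  mul : ∀ {A B C} {p : X A B} {q : X B C} (h : src p = tgt q), fib p → fib q → fib (comp p q h)
  star : ∀ {A B} {p : X A B}, fib p → fib (inv p)
  one : ∀ {A} (p : X A A), fib p

attribute [instance] SpaceoidData.topX SpaceoidData.normedAddCommGroup SpaceoidData.normedSpace

namespace SpaceoidData

/-- The part of the total space lying over `X A B`. -/
abbrev Total (𝓔 : SpaceoidData.{u}) (A B : 𝓔.Obj) : Type u :=
  Bundle.TotalSpace ℂ (fun p : 𝓔.X A B => 𝓔.fib p)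

instance (𝓔 : SpaceoidData.{u}) (A B : 𝓔.Obj) : TopologicalSpace (𝓔.Total A B) :=
  𝓔.topTotal A B

/-- A point of the total space. -/
abbrev pt (𝓔 : SpaceoidData.{u}) {A B : 𝓔.Obj} {p : 𝓔.X A B} (e : 𝓔.fib p) : 𝓔.Total A B :=
  ⟨p, e⟩

/-- The base is a non-full base spaceoid: a topological groupoid whose diagonal fibers are compact
Hausdorff and consist of identities, with source and target maps homeomorphisms onto open sets. -/
structure IsBaseSpaceoid (𝓔 : SpaceoidData.{u}) : Prop where
  tgt_diag : ∀ {A} (p : 𝓔.X A A), 𝓔.tgt p = p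
  src_diag : ∀ {A} (p : 𝓔.X A A), 𝓔.src p = p
  tgt_comp : ∀ {A B C} (p : 𝓔.X A B) (q : 𝓔.X B C) (h : 𝓔.src p = 𝓔.tgt q),
    𝓔.tgt (𝓔.comp p q h) = 𝓔.tgt p
  src_comp : ∀ {A B C} (p : 𝓔.X A B) (q : 𝓔.X B C) (h : 𝓔.src p = 𝓔.tgt q),
    𝓔.src (𝓔.comp p q h) = 𝓔.src q
  tgt_inv : ∀ {A B} (p : 𝓔.X A B), 𝓔.tgt (𝓔.inv p) = 𝓔.src p
  src_inv : ∀ {A B} (p : 𝓔.X A B), 𝓔.src (𝓔.inv p) = 𝓔.tgt p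
  comp_assoc : ∀ {A B C D} (p : 𝓔.X A B) (q : 𝓔.X B C) (r : 𝓔.X C D) h h' h₁ h₁',
    𝓔.comp (𝓔.comp p q h) r h' = 𝓔.comp p (𝓔.comp q r h₁) h₁'
  tgt_id_comp : ∀ {A B} (p : 𝓔.X A B) h, 𝓔.comp (𝓔.tgt p) p h = p
  comp_src_id : ∀ {A B} (p : 𝓔.X A B) h, 𝓔.comp p (𝓔.src p) h = p
  comp_inv : ∀ {A B} (p : 𝓔.X A B) h, 𝓔.comp p (𝓔.inv p) h = 𝓔.tgt p
  inv_comp : ∀ {A B} (p : 𝓔.X A B) h, 𝓔.comp (𝓔.inv p) p h = 𝓔.src p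
  continuous_comp : ∀ A B C, Continuous
    (fun z : {z : 𝓔.X A B × 𝓔.X B C // 𝓔.src z.1 = 𝓔.tgt z.2} => 𝓔.comp z.1.1 z.1.2 z.2)
  continuous_inv : ∀ A B, Continuous (𝓔.inv : 𝓔.X A B → 𝓔.X B A)
  compact_diag : ∀ A, CompactSpace (𝓔.X A A)
  t2_diag : ∀ A, T2Space (𝓔.X A A)
  tgt_openEmbedding : ∀ A B, IsOpenEmbedding (𝓔.tgt : 𝓔.X A B → 𝓔.X A A)
  src_openEmbedding : ∀ A B, IsOpenEmbedding (𝓔.src : 𝓔.X A B → 𝓔.X B B)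

/-- The bundle is a saturated Banach line-bundle of Fell type. -/
structure IsBanachLineBundle (𝓔 : SpaceoidData.{u}) : Prop where
  complete : ∀ {A B} (p : 𝓔.X A B), CompleteSpace (𝓔.fib p)
  rank_one : ∀ {A B} (p : 𝓔.X A B), Module.finrank ℂ (𝓔.fib p) = 1
  continuous_proj : ∀ A B, Continuous (fun e : 𝓔.Total A B => e.proj)
  isOpenMap_proj : ∀ A B, IsOpenMap (fun e : 𝓔.Total A B => e.proj)
  continuous_add : ∀ A B, Continuous[
      TopologicalSpace.induced (fun z => (𝓔.pt z.2.1, 𝓔.pt z.2.2)) inferInstance, inferInstance]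
    (fun z : (Σ p : 𝓔.X A B, 𝓔.fib p × 𝓔.fib p) => 𝓔.pt (z.2.1 + z.2.2))
  continuous_smul : ∀ A B, Continuous (fun z : ℂ × 𝓔.Total A B => 𝓔.pt (z.1 • z.2.snd))
  continuous_zero : ∀ A B, Continuous (fun p : 𝓔.X A B => 𝓔.pt (0 : 𝓔.fib p))
  continuous_norm : ∀ A B, Continuous (fun e : 𝓔.Total A B => ‖e.snd‖)
  isInducing_fib : ∀ {A B} (p : 𝓔.X A B), IsInducing (fun e : 𝓔.fib p => 𝓔.pt e)
  tubular : ∀ {A B} (p : 𝓔.X A B), ∀ U ∈ 𝓝 (𝓔.pt (0 : 𝓔.fib p)),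
    ∃ ε > 0, ∃ O : Set (𝓔.X A B), IsOpen O ∧ p ∈ O ∧
      ∀ e : 𝓔.Total A B, e.proj ∈ O → ‖e.snd‖ < ε → e ∈ U
  saturated : ∀ {A B} (e : 𝓔.Total A B), ∃ σ : ∀ p : 𝓔.X A B, 𝓔.fib p,
    Continuous (fun p => 𝓔.pt (σ p)) ∧ σ e.proj = e.snd

/-- The bundle is a unital Fell bundle over the groupoid, i.e. an involutive algebroid over it,
with continuous operations, satisfying the C*-conditions. Equations between elements of fibers
over points which are only propositionally equal are stated in the total space. Positivity of
`e* ∘ e` in the C*-algebra `fib (src p)` is expressed as `e* ∘ e = f* ∘ f` with `f` in it. -/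
structure IsFellBundle (𝓔 : SpaceoidData.{u}) : Prop where
  add_mul : ∀ {A B C} {p : 𝓔.X A B} {q : 𝓔.X B C} (h : 𝓔.src p = 𝓔.tgt q)
    (e e' : 𝓔.fib p) (f : 𝓔.fib q), 𝓔.mul h (e + e') f = 𝓔.mul h e f + 𝓔.mul h e' f
  mul_add : ∀ {A B C} {p : 𝓔.X A B} {q : 𝓔.X B C} (h : 𝓔.src p = 𝓔.tgt q)
    (e : 𝓔.fib p) (f f' : 𝓔.fib q), 𝓔.mul h e (f + f') = 𝓔.mul h e f + 𝓔.mul h e f'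
  smul_mul : ∀ {A B C} {p : 𝓔.X A B} {q : 𝓔.X B C} (h : 𝓔.src p = 𝓔.tgt q) (a : ℂ)
    (e : 𝓔.fib p) (f : 𝓔.fib q), 𝓔.mul h (a • e) f = a • 𝓔.mul h e f
  mul_smul : ∀ {A B C} {p : 𝓔.X A B} {q : 𝓔.X B C} (h : 𝓔.src p = 𝓔.tgt q) (a : ℂ)
    (e : 𝓔.fib p) (f : 𝓔.fib q), 𝓔.mul h e (a • f) = a • 𝓔.mul h e f
  mul_assoc : ∀ {A B C D} {p : 𝓔.X A B} {q : 𝓔.X B C} {r : 𝓔.X C D}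
    (e : 𝓔.fib p) (f : 𝓔.fib q) (g : 𝓔.fib r) h h' h₁ h₁',
    𝓔.pt (𝓔.mul h' (𝓔.mul h e f) g) = 𝓔.pt (𝓔.mul h₁' e (𝓔.mul h₁ f g))
  one_mul : ∀ {A B} {p : 𝓔.X A B} (e : 𝓔.fib p) h,
    𝓔.pt (𝓔.mul h (𝓔.one (𝓔.tgt p)) e) = 𝓔.pt e
  mul_one : ∀ {A B} {p : 𝓔.X A B} (e : 𝓔.fib p) h,
    𝓔.pt (𝓔.mul h e (𝓔.one (𝓔.src p))) = 𝓔.pt e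
  star_star : ∀ {A B} {p : 𝓔.X A B} (e : 𝓔.fib p), 𝓔.pt (𝓔.star (𝓔.star e)) = 𝓔.pt e
  star_one : ∀ {A} (p : 𝓔.X A A), 𝓔.pt (𝓔.star (𝓔.one p)) = 𝓔.pt (𝓔.one p)
  star_mul : ∀ {A B C} {p : 𝓔.X A B} {q : 𝓔.X B C} (e : 𝓔.fib p) (f : 𝓔.fib q) h h',
    𝓔.pt (𝓔.star (𝓔.mul h e f)) = 𝓔.pt (𝓔.mul h' (𝓔.star f) (𝓔.star e))
  star_add : ∀ {A B} {p : 𝓔.X A B} (e f : 𝓔.fib p),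
    𝓔.star (e + f) = 𝓔.star e + 𝓔.star f
  star_smul : ∀ {A B} {p : 𝓔.X A B} (a : ℂ) (e : 𝓔.fib p),
    𝓔.star (a • e) = (starRingEnd ℂ) a • 𝓔.star e
  norm_mul_le : ∀ {A B C} {p : 𝓔.X A B} {q : 𝓔.X B C} (h : 𝓔.src p = 𝓔.tgt q)
    (e : 𝓔.fib p) (f : 𝓔.fib q), ‖𝓔.mul h e f‖ ≤ ‖e‖ * ‖f‖
  norm_star_mul_self : ∀ {A B} {p : 𝓔.X A B} (e : 𝓔.fib p) h,
    ‖𝓔.mul h (𝓔.star e) e‖ = ‖e‖ ^ 2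
  star_mul_self_pos : ∀ {A B} {p : 𝓔.X A B} (e : 𝓔.fib p) h h',
    ∃ f : 𝓔.fib (𝓔.src p), 𝓔.pt (𝓔.mul h (𝓔.star e) e) = 𝓔.pt (𝓔.mul h' (𝓔.star f) f)
  continuous_mul : ∀ A B C, Continuous
    (fun z : {z : 𝓔.Total A B × 𝓔.Total B C // 𝓔.src z.1.proj = 𝓔.tgt z.2.proj} =>
      𝓔.pt (𝓔.mul z.2 z.1.1.snd z.1.2.snd))
  continuous_star : ∀ A B, Continuous (fun e : 𝓔.Total A B => 𝓔.pt (𝓔.star e.snd))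
  continuous_one : ∀ A, Continuous (fun p : 𝓔.X A A => 𝓔.pt (𝓔.one p))

/-- A non-full spaceoid: a saturated unital Fell line-bundle over a non-full base spaceoid. -/
structure IsSpaceoid (𝓔 : SpaceoidData.{u}) : Prop where
  base : 𝓔.IsBaseSpaceoid
  lineBundle : 𝓔.IsBanachLineBundle
  fell : 𝓔.IsFellBundle

/-- The data of a morphism `(f, F) : 𝓔₁ → 𝓔₂`. The bijection between the index sets is
recorded through its inverse `obj : 𝓔₂.Obj → 𝓔₁.Obj`. -/
structure Mor (𝓔₁ 𝓔₂ : SpaceoidData.{u}) where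
  obj : 𝓔₂.Obj → 𝓔₁.Obj
  base : ∀ {A B}, 𝓔₁.X (obj A) (obj B) → 𝓔₂.X A B
  fibMap : ∀ {A B} (p : 𝓔₁.X (obj A) (obj B)), 𝓔₂.fib (base p) →ₗ[ℂ] 𝓔₁.fib p

/-- Morphisms of non-full spaceoids: Takahashi morphisms of Fell bundles over a bijection of the
index sets, with `f` converging at infinity and `F` vanishing at infinity. -/
structure Mor.IsMorphism {𝓔₁ 𝓔₂ : SpaceoidData.{u}} (f : Mor 𝓔₁ 𝓔₂) : Prop where
  bijective : Function.Bijective f.obj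
  base_tgt : ∀ {A B} (p : 𝓔₁.X (f.obj A) (f.obj B)), f.base (𝓔₁.tgt p) = 𝓔₂.tgt (f.base p)
  base_src : ∀ {A B} (p : 𝓔₁.X (f.obj A) (f.obj B)), f.base (𝓔₁.src p) = 𝓔₂.src (f.base p)
  base_comp : ∀ {A B C} (p : 𝓔₁.X (f.obj A) (f.obj B)) (q : 𝓔₁.X (f.obj B) (f.obj C)) h h',
    f.base (𝓔₁.comp p q h) = 𝓔₂.comp (f.base p) (f.base q) h'
  base_inv : ∀ {A B} (p : 𝓔₁.X (f.obj A) (f.obj B)), f.base (𝓔₁.inv p) = 𝓔₂.inv (f.base p)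
  continuous_base : ∀ A B, Continuous (f.base : 𝓔₁.X (f.obj A) (f.obj B) → 𝓔₂.X A B)
  converging : ∀ {A B} (K : Set (𝓔₂.X A B)), IsCompact K →
    ∃ L : Set (𝓔₁.X (f.obj A) (f.obj B)), IsCompact L ∧ ∀ p ∉ L, f.base p ∉ K
  fibMap_mul : ∀ {A B C} {p : 𝓔₁.X (f.obj A) (f.obj B)} {q : 𝓔₁.X (f.obj B) (f.obj C)} h h'
    (e : 𝓔₂.fib (f.base p)) (e' : 𝓔₂.fib (f.base q)) (g : 𝓔₂.fib (f.base (𝓔₁.comp p q h))),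
    𝓔₂.pt g = 𝓔₂.pt (𝓔₂.mul h' e e') → f.fibMap _ g = 𝓔₁.mul h (f.fibMap p e) (f.fibMap q e')
  fibMap_star : ∀ {A B} {p : 𝓔₁.X (f.obj A) (f.obj B)} (e : 𝓔₂.fib (f.base p))
    (g : 𝓔₂.fib (f.base (𝓔₁.inv p))),
    𝓔₂.pt g = 𝓔₂.pt (𝓔₂.star e) → f.fibMap _ g = 𝓔₁.star (f.fibMap p e)
  fibMap_one : ∀ {A} (p : 𝓔₁.X (f.obj A) (f.obj A)),
    f.fibMap p (𝓔₂.one (f.base p)) = 𝓔₁.one p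
  continuous_fibMap : ∀ A B, Continuous[
      TopologicalSpace.induced (fun z => (z.1, 𝓔₂.pt z.2)) inferInstance, inferInstance]
    (fun z : (Σ p : 𝓔₁.X (f.obj A) (f.obj B), 𝓔₂.fib (f.base p)) => 𝓔₁.pt (f.fibMap z.1 z.2))
  vanishing : ∀ A B, ∀ ε > 0, ∀ K : Set (𝓔₁.X (f.obj A) (f.obj B)), IsCompact K →
    ∃ δ > 0, ∃ L : Set (𝓔₁.X (f.obj A) (f.obj B)), IsCompact L ∧
      ∀ p ∉ L, ∀ e : 𝓔₂.fib (f.base p), ‖e‖ < δ → p ∉ K ∧ ‖f.fibMap p e‖ < ε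

/-! ### The section functor -/

/-- Sections of the bundle over `X A B`. -/
abbrev Section (𝓔 : SpaceoidData.{u}) (A B : 𝓔.Obj) : Type u := ∀ p : 𝓔.X A B, 𝓔.fib p

/-- Continuous sections vanishing at infinity. -/
structure Section.IsC0 {𝓔 : SpaceoidData.{u}} {A B : 𝓔.Obj} (σ : 𝓔.Section A B) : Prop where
  continuous : Continuous (fun p => 𝓔.pt (σ p))
  vanishing : ∀ ε > 0, ∃ K : Set (𝓔.X A B), IsCompact K ∧ ∀ p ∉ K, ‖σ p‖ < ε

open Classical in
/-- The composition of sections: `(σ ∘ ρ)(p ∘ q) = σ(p) ∘ ρ(q)`, and zero at the points which are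
not of the form `p ∘ q`. -/
def Section.comp {𝓔 : SpaceoidData.{u}} {A B C : 𝓔.Obj} (σ : 𝓔.Section A B)
    (ρ : 𝓔.Section B C) : 𝓔.Section A C := fun r =>
  if h : ∃ z : {z : 𝓔.X A B × 𝓔.X B C // 𝓔.src z.1 = 𝓔.tgt z.2}, 𝓔.comp z.1.1 z.1.2 z.2 = r then
    h.choose_spec ▸ 𝓔.mul h.choose.2 (σ h.choose.1.1) (ρ h.choose.1.2)
  else 0

open Classical in
/-- The involution of sections: `σ*(p⁻¹) = σ(p)*`. In a groupoid every point is of the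
form `p⁻¹`. -/
def Section.star {𝓔 : SpaceoidData.{u}} {A B : 𝓔.Obj} (σ : 𝓔.Section A B) :
    𝓔.Section B A := fun q =>
  if h : ∃ p : 𝓔.X A B, 𝓔.inv p = q then h.choose_spec ▸ 𝓔.star (σ h.choose) else 0

/-- The operations on continuous sections vanishing at infinity are well defined, and the
supremum norm of such a section is finite. -/
structure SectionsClosed (𝓔 : SpaceoidData.{u}) : Prop where
  zero : ∀ A B, (0 : 𝓔.Section A B).IsC0
  add : ∀ {A B} {σ ρ : 𝓔.Section A B}, σ.IsC0 → ρ.IsC0 → (σ + ρ).IsC0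
  smul : ∀ {A B} (a : ℂ) {σ : 𝓔.Section A B}, σ.IsC0 → (a • σ).IsC0
  comp : ∀ {A B C} {σ : 𝓔.Section A B} {ρ : 𝓔.Section B C},
    σ.IsC0 → ρ.IsC0 → (σ.comp ρ).IsC0
  star : ∀ {A B} {σ : 𝓔.Section A B}, σ.IsC0 → σ.star.IsC0
  one : ∀ A, Section.IsC0 (fun p : 𝓔.X A A => 𝓔.one p)
  bddAbove : ∀ {A B} {σ : 𝓔.Section A B}, σ.IsC0 → BddAbove (Set.range fun p => ‖σ p‖)

/-- The space `Γ(𝓔)_{AB}`. -/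
def sections (𝓔 : SpaceoidData.{u}) (h𝓔 : 𝓔.SectionsClosed) (A B : 𝓔.Obj) :
    Submodule ℂ (𝓔.Section A B) where
  carrier := {σ | σ.IsC0}
  zero_mem' := h𝓔.zero A B
  add_mem' := h𝓔.add
  smul_mem' a _ := h𝓔.smul a

/-- The supremum norm on `Γ(𝓔)_{AB}`. -/
instance (𝓔 : SpaceoidData.{u}) (h𝓔 : 𝓔.SectionsClosed) (A B : 𝓔.Obj) :
    Norm (𝓔.sections h𝓔 A B) :=
  ⟨fun σ => ⨆ p, ‖σ.1 p‖⟩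

theorem sections_normCore (𝓔 : SpaceoidData.{u}) (h𝓔 : 𝓔.SectionsClosed) (A B : 𝓔.Obj) :
    NormedSpace.Core ℂ (𝓔.sections h𝓔 A B) where
  norm_nonneg σ := Real.iSup_nonneg fun p => norm_nonneg (σ.1 p)
  norm_smul a σ := by
    change (⨆ p, ‖a • σ.1 p‖) = ‖a‖ * ⨆ p, ‖σ.1 p‖
    simp_rw [norm_smul]
    exact (Real.mul_iSup_of_nonneg (norm_nonneg a) _).symm
  norm_triangle σ ρ := by
    change (⨆ p, ‖σ.1 p + ρ.1 p‖) ≤ (⨆ p, ‖σ.1 p‖) + ⨆ p, ‖ρ.1 p‖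
    refine Real.iSup_le (fun p => (norm_add_le _ _).trans (add_le_add ?_ ?_))
      (add_nonneg (Real.iSup_nonneg fun p => norm_nonneg _)
        (Real.iSup_nonneg fun p => norm_nonneg _))
    · exact le_ciSup (h𝓔.bddAbove σ.2) p
    · exact le_ciSup (h𝓔.bddAbove ρ.2) p
  norm_eq_zero_iff σ := by
    constructor
    · intro h
      ext p
      have h1 : ‖σ.1 p‖ ≤ ⨆ p, ‖σ.1 p‖ := le_ciSup (h𝓔.bddAbove σ.2) p
      have h2 : (⨆ p, ‖σ.1 p‖) = 0 := h
      rw [h2] at h1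
      exact norm_le_zero_iff.1 h1
    · rintro rfl
      change (⨆ p : 𝓔.X A B, ‖(0 : 𝓔.fib p)‖) = 0
      simp

instance (𝓔 : SpaceoidData.{u}) (h𝓔 : 𝓔.SectionsClosed) (A B : 𝓔.Obj) :
    NormedAddCommGroup (𝓔.sections h𝓔 A B) :=
  NormedAddCommGroup.ofCore (𝓔.sections_normCore h𝓔 A B)

instance (𝓔 : SpaceoidData.{u}) (h𝓔 : 𝓔.SectionsClosed) (A B : 𝓔.Obj) :
    NormedSpace ℂ (𝓔.sections h𝓔 A B) :=
  NormedSpace.ofCore (𝓔.sections_normCore h𝓔 A B)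

/-- The section category `Γ(𝓔)`. -/
@[reducible] def Gamma (𝓔 : SpaceoidData.{u}) (h𝓔 : 𝓔.SectionsClosed) : CStarCatData.{u} where
  Obj := 𝓔.Obj
  Hom A B := 𝓔.sections h𝓔 A B
  one A := ⟨fun p => 𝓔.one p, h𝓔.one A⟩
  comp σ ρ := ⟨σ.1.comp ρ.1, h𝓔.comp σ.2 ρ.2⟩
  star σ := ⟨σ.1.star, h𝓔.star σ.2⟩

/-- The pull-back `F ∘ f^•(σ)` of a section along `(f, F)`. -/
def Mor.pullSection {𝓔₁ 𝓔₂ : SpaceoidData.{u}} (f : Mor 𝓔₁ 𝓔₂) {A B : 𝓔₂.Obj}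
    (σ : 𝓔₂.Section A B) : 𝓔₁.Section (f.obj A) (f.obj B) := fun p => f.fibMap p (σ (f.base p))

/-- The functor `Γ_{(f, F)} : Γ(𝓔₂) → Γ(𝓔₁)`. -/
def Mor.Gamma {𝓔₁ 𝓔₂ : SpaceoidData.{u}} (f : Mor 𝓔₁ 𝓔₂) (h₁ : 𝓔₁.SectionsClosed)
    (h₂ : 𝓔₂.SectionsClosed)
    (hf : ∀ {A B} {σ : 𝓔₂.Section A B}, σ.IsC0 → (f.pullSection σ).IsC0) :
    (𝓔₂.Gamma h₂).LinFunctor (𝓔₁.Gamma h₁) where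
  obj := f.obj
  map :=
    { toFun := fun σ => ⟨f.pullSection σ.1, hf σ.2⟩
      map_add' := fun _ _ => Subtype.ext (funext fun p => (f.fibMap p).map_add _ _)
      map_smul' := fun _ _ => Subtype.ext (funext fun p => (f.fibMap p).map_smul _ _) }

end SpaceoidData

/-! ### The spectrum functor -/

namespace CommCStarCat

variable (𝒞 : CommCStarCat.{u})

/-- Characters are contractive. -/
theorem norm_app_le (ω : 𝒞.Character) {A B : 𝒞.Obj} (x : 𝒞.Hom A B) :
    ‖ω.app A B x‖ ≤ ‖x‖ := by
  have key : ∀ a : 𝒞.Hom B B, ‖ω.app B B a‖ ≤ ‖a‖ := by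
    intro a
    by_contra! hlt
    have hne : ω.app B B a ≠ 0 := fun h => by
      rw [h, norm_zero] at hlt
      exact absurd (norm_nonneg a) (not_le.2 hlt)
    set w : 𝒞.Hom B B := (ω.app B B a)⁻¹ • a with hw
    have hw1 : ‖w‖ < 1 := by
      rw [hw, norm_smul, norm_inv, inv_mul_lt_iff₀ (norm_pos_iff.2 hne), mul_one]
      exact hlt
    have hωw : ω.app B B w = 1 := by simp [hw, hne]
    have := 𝒞.isComm.complete B B
    have hc : ContractingWith ‖w‖₊ (fun v : 𝒞.Hom B B => w + 𝒞.comp w v) := by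
      refine ⟨by exact_mod_cast hw1, LipschitzWith.of_dist_le_mul fun v v' => ?_⟩
      rw [dist_add_left, dist_eq_norm, dist_eq_norm, coe_nnnorm]
      have : 𝒞.comp w v - 𝒞.comp w v' = 𝒞.comp w (v - v') := by
        rw [sub_eq_add_neg, sub_eq_add_neg, 𝒞.isComm.comp_add, ← neg_one_smul ℂ v',
          𝒞.isComm.comp_smul, neg_one_smul]
      rw [this]
      exact 𝒞.isComm.norm_comp_le _ _
    have : Nonempty (𝒞.Hom B B) := ⟨0⟩
    have hfix : w + 𝒞.comp w (ContractingWith.fixedPoint _ hc) = ContractingWith.fixedPoint _ hc :=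
      hc.fixedPoint_isFixedPt
    have := congrArg (ω.app B B) hfix
    rw [map_add, ω.map_comp, hωw, one_mul] at this
    simp at this
  have h1 := key (𝒞.comp (𝒞.star x) x)
  rw [ω.map_comp, ω.map_star, 𝒞.isComm.norm_star_comp_self, norm_mul, RCLike.norm_conj,
    ← sq] at h1
  exact (sq_le_sq₀ (norm_nonneg _) (norm_nonneg _)).1 h1

/-- Two characters are equivalent over `(A, B)` if their restrictions to `𝒞_{AB}` agree up to a
phase. -/
def charSetoid (A B : 𝒞.Obj) : Setoid 𝒞.Character where
  r ω ρ := ∃ u : Circle, ∀ x, ρ.app A B x = u * ω.app A B x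
  iseqv :=
    ⟨fun ω => ⟨1, fun x => by simp⟩,
      fun {ω ρ} ⟨u, hu⟩ => ⟨u⁻¹, fun x => by rw [hu x, ← mul_assoc]; simp⟩,
      fun {ω ρ τ} ⟨u, hu⟩ ⟨v, hv⟩ => ⟨v * u, fun x => by rw [hv x, hu x]; simp [mul_assoc]⟩⟩

/-- The space of the classes `[ω]_{AB}`, with the quotient of the weak-`*` topology. -/
abbrev CharClass (A B : 𝒞.Obj) : Type u := Quotient (𝒞.charSetoid A B)

variable {𝒞}

/-- `ker(ω)_{AB}`, which depends only on the class `[ω]_{AB}`. -/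
def CharClass.ker {A B : 𝒞.Obj} (b : 𝒞.CharClass A B) : Submodule ℂ (𝒞.Hom A B) :=
  Quotient.lift (fun ω : 𝒞.Character => LinearMap.ker (ω.app A B))
    (by
      rintro ω ρ ⟨u, hu⟩
      ext x
      simp [hu x]) b

instance CharClass.isClosed_ker {A B : 𝒞.Obj} (b : 𝒞.CharClass A B) :
    IsClosed (b.ker : Set (𝒞.Hom A B)) := by
  induction b using Quotient.inductionOn with
  | h ω =>
    have hc : Continuous (ω.app A B) :=
      AddMonoidHomClass.continuous_of_bound (ω.app A B) 1 fun x => by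
        simpa using 𝒞.norm_app_le ω x
    exact isClosed_singleton.preimage hc

variable (𝒞) in
/-- `𝒳_{AB}`: the classes `[ω]_{AB}` such that `𝒞_{AB} / ker(ω)_{AB}` is one-dimensional. -/
abbrev SpecX (A B : 𝒞.Obj) : Type u :=
  {b : 𝒞.CharClass A B // Module.finrank ℂ (𝒞.Hom A B ⧸ b.ker) = 1}

theorem CharClass.finrank_mk {A B : 𝒞.Obj} (ω : 𝒞.Character) :
    Module.finrank ℂ (𝒞.Hom A B ⧸ CharClass.ker (Quotient.mk (𝒞.charSetoid A B) ω)) = 1 ↔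
      ∃ x, ω.app A B x ≠ 0 := by
  change Module.finrank ℂ (𝒞.Hom A B ⧸ LinearMap.ker (ω.app A B)) = 1 ↔ _
  rw [(ω.app A B).quotKerEquivRange.finrank_eq]
  constructor
  · intro h
    by_contra! h0
    have : ω.app A B = 0 := LinearMap.ext h0
    rw [this, LinearMap.range_zero, finrank_bot] at h
    exact zero_ne_one h
  · rintro ⟨x, hx⟩
    have : LinearMap.range (ω.app A B) = ⊤ :=
      LinearMap.range_eq_top.2 (LinearMap.surjective fun h => hx (by rw [h]; rfl))
    rw [this, finrank_top, Module.finrank_self]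

/-- The point `[ω]_{AB}` of `𝒳_{AB}`. -/
def SpecX.mk (ω : 𝒞.Character) {A B : 𝒞.Obj} (h : ∃ x, ω.app A B x ≠ 0) : 𝒞.SpecX A B :=
  ⟨Quotient.mk _ ω, (CharClass.finrank_mk ω).2 h⟩

/-- A character representing a point of `𝒳_{AB}`. -/
def SpecX.rep {A B : 𝒞.Obj} (p : 𝒞.SpecX A B) : 𝒞.Character := Quotient.out p.1

theorem SpecX.mk_rep {A B : 𝒞.Obj} (p : 𝒞.SpecX A B) :
    Quotient.mk (𝒞.charSetoid A B) p.rep = p.1 := Quotient.out_eq p.1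

theorem SpecX.rep_ne {A B : 𝒞.Obj} (p : 𝒞.SpecX A B) : ∃ x, p.rep.app A B x ≠ 0 :=
  (CharClass.finrank_mk p.rep).1 (by rw [p.mk_rep]; exact p.2)

theorem SpecX.mem_ker {A B : 𝒞.Obj} (p : 𝒞.SpecX A B) (x : 𝒞.Hom A B) :
    x ∈ p.1.ker ↔ p.rep.app A B x = 0 := by
  rw [← p.mk_rep]
  rfl

theorem SpecX.mem_ker_mk (ω : 𝒞.Character) {A B : 𝒞.Obj} (h : ∃ x, ω.app A B x ≠ 0)
    (x : 𝒞.Hom A B) : x ∈ (SpecX.mk ω h).1.ker ↔ ω.app A B x = 0 := Iff.rfl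

theorem app_inv_ne {ω : 𝒞.Character} {A B : 𝒞.Obj} (h : ∃ x, ω.app A B x ≠ 0) :
    ∃ x, ω.app B A x ≠ 0 := by
  obtain ⟨x, hx⟩ := h
  exact ⟨𝒞.star x, by simpa [ω.map_star] using hx⟩

theorem app_comp_ne {ω : 𝒞.Character} {A B C : 𝒞.Obj} (h : ∃ x, ω.app A B x ≠ 0)
    (h' : ∃ x, ω.app B C x ≠ 0) : ∃ x, ω.app A C x ≠ 0 := by
  obtain ⟨x, hx⟩ := h
  obtain ⟨y, hy⟩ := h'
  exact ⟨𝒞.comp x y, by rw [ω.map_comp]; exact mul_ne_zero hx hy⟩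

/-- The target `[ω]_{AB} ↦ [ω]_{AA}`. -/
def SpecX.tgt {A B : 𝒞.Obj} (p : 𝒞.SpecX A B) : 𝒞.SpecX A A :=
  SpecX.mk p.rep (app_comp_ne p.rep_ne (app_inv_ne p.rep_ne))

/-- The source `[ω]_{AB} ↦ [ω]_{BB}`. -/
def SpecX.src {A B : 𝒞.Obj} (p : 𝒞.SpecX A B) : 𝒞.SpecX B B :=
  SpecX.mk p.rep (app_comp_ne (app_inv_ne p.rep_ne) p.rep_ne)

/-- The inverse `[ω]_{AB} ↦ [ω]_{BA}`. -/
def SpecX.inv {A B : 𝒞.Obj} (p : 𝒞.SpecX A B) : 𝒞.SpecX B A :=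
  SpecX.mk p.rep (app_inv_ne p.rep_ne)

theorem SpecX.rep_zero_iff {A B C : 𝒞.Obj} {p : 𝒞.SpecX A B} {q : 𝒞.SpecX B C}
    (h : p.src = q.tgt) (y : 𝒞.Hom B C) :
    p.rep.app B C y = 0 ↔ q.rep.app B C y = 0 := by
  obtain ⟨u, hu⟩ := Quotient.exact (congrArg Subtype.val h)
  have h1 := hu (𝒞.comp y (𝒞.star y))
  rw [p.rep.map_comp, q.rep.map_comp, p.rep.map_star, q.rep.map_star, Complex.mul_conj,
    Complex.mul_conj] at h1
  constructor
  · intro h0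
    rw [h0] at h1
    simpa using h1
  · intro h0
    rw [h0] at h1
    simpa using h1.symm

/-- The composition `[ω]_{AB} ∘ [ω]_{BC} = [ω]_{AC}`. If `[ω]_{BB} = [ρ]_{BB}` then a
representative `ω` of the first factor `[ω]_{AB}` also represents the second factor `[ρ]_{BC}`. -/
def SpecX.comp {A B C : 𝒞.Obj} (p : 𝒞.SpecX A B) (q : 𝒞.SpecX B C) (h : p.src = q.tgt) :
    𝒞.SpecX A C :=
  SpecX.mk p.rep (app_comp_ne p.rep_ne
    (q.rep_ne.imp fun y hy => fun h0 => hy ((rep_zero_iff h y).1 h0)))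

/-- The fiber `(𝒞 / ker ω)_{AB}` over `[ω]_{AB}`, with the quotient norm. -/
def SpecFib {A B : 𝒞.Obj} (p : 𝒞.SpecX A B) : Type u := 𝒞.Hom A B ⧸ p.1.ker

instance {A B : 𝒞.Obj} (p : 𝒞.SpecX A B) : NormedAddCommGroup (SpecFib p) :=
  inferInstanceAs (NormedAddCommGroup (𝒞.Hom A B ⧸ p.1.ker))

instance {A B : 𝒞.Obj} (p : 𝒞.SpecX A B) : NormedSpace ℂ (SpecFib p) :=
  inferInstanceAs (NormedSpace ℂ (𝒞.Hom A B ⧸ p.1.ker))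

/-- The quotient map `x ↦ x + ker(ω)_{AB}`. -/
def SpecFib.mk {A B : 𝒞.Obj} (p : 𝒞.SpecX A B) : 𝒞.Hom A B →ₗ[ℂ] SpecFib p :=
  p.1.ker.mkQ

/-- The Gel'fand transform `x̂ : [ω]_{AB} ↦ x + ker(ω)_{AB}`. -/
def gelfandSection {A B : 𝒞.Obj} (x : 𝒞.Hom A B) (p : 𝒞.SpecX A B) : SpecFib p :=
  SpecFib.mk p x

/-- `(x + ker ω)_{AB} ∘ (y + ker ω)_{BC} = (x ∘ y + ker ω)_{AC}`. -/
def SpecFib.mul {A B C : 𝒞.Obj} {p : 𝒞.SpecX A B} {q : 𝒞.SpecX B C} (h : p.src = q.tgt) :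
    SpecFib p → SpecFib q → SpecFib (p.comp q h) :=
  Quotient.map₂ 𝒞.comp fun x x' hx y y' hy => by
    have hx' := (p.mem_ker _).1 ((Submodule.quotientRel_def _).1 hx)
    have hy' := (SpecX.rep_zero_iff h _).2 ((q.mem_ker _).1 ((Submodule.quotientRel_def _).1 hy))
    refine (Submodule.quotientRel_def _).2 ((SpecX.mem_ker_mk _ _ _).2 ?_)
    rw [map_sub, sub_eq_zero] at hx' hy' ⊢
    rw [p.rep.map_comp, p.rep.map_comp, hx', hy']

/-- `((x + ker ω)_{AB})* = (x* + ker ω)_{BA}`. -/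
def SpecFib.star {A B : 𝒞.Obj} {p : 𝒞.SpecX A B} : SpecFib p → SpecFib p.inv :=
  Quotient.map 𝒞.star fun x x' hx => by
    have hx' := (p.mem_ker _).1 ((Submodule.quotientRel_def _).1 hx)
    refine (Submodule.quotientRel_def _).2 ((SpecX.mem_ker_mk _ _ _).2 ?_)
    rw [map_sub, sub_eq_zero] at hx' ⊢
    rw [p.rep.map_star, p.rep.map_star, hx']

variable (𝒞) in
/-- The tubular topology on the total space over `𝒳_{AB}`, generated by the tubes around the
Gel'fand transforms over open subsets of the base. -/
@[reducible] def tubularTopology (A B : 𝒞.Obj) :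
    TopologicalSpace (Bundle.TotalSpace ℂ (fun p : 𝒞.SpecX A B => SpecFib p)) :=
  TopologicalSpace.generateFrom
    {U | ∃ (x : 𝒞.Hom A B) (ε : ℝ) (O : Set (𝒞.SpecX A B)), 0 < ε ∧ IsOpen O ∧
      U = {e | e.proj ∈ O ∧ ‖(show SpecFib e.proj from e.snd) - SpecFib.mk e.proj x‖ < ε}}

/-- The spectral spaceoid `Σ(𝒞)`, with the tubular topology on the total space. -/
@[reducible] def spectrum (𝒞 : CommCStarCat.{u}) : SpaceoidData.{u} where
  Obj := 𝒞.Obj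
  X A B := 𝒞.SpecX A B
  tgt := SpecX.tgt
  src := SpecX.src
  comp := SpecX.comp
  inv := SpecX.inv
  fib := SpecFib
  topTotal A B := 𝒞.tubularTopology A B
  mul := SpecFib.mul
  star := SpecFib.star
  one p := gelfandSection (𝒞.one _) p

variable {𝒟 : CommCStarCat.{u}}

/-- The map `[ω]_{AB} ↦ [ω ∘ φ]_{AB}` on classes of characters. -/
def CharClass.pullback (φ : 𝒞 ⟶ 𝒟) {A B : 𝒞.Obj} :
    𝒟.CharClass (φ.obj A) (φ.obj B) → 𝒞.CharClass A B :=
  Quotient.map (CStarCatData.Character.pullback φ) fun _ _ ⟨u, hu⟩ => ⟨u, fun x => hu (φ.map x)⟩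

theorem CharClass.ker_pullback (φ : 𝒞 ⟶ 𝒟) {A B : 𝒞.Obj}
    (b : 𝒟.CharClass (φ.obj A) (φ.obj B)) :
    (b.pullback φ).ker = b.ker.comap φ.map := by
  induction b using Quotient.inductionOn with
  | h ω => rfl

theorem CharClass.finrank_pullback (φ : 𝒞 ⟶ 𝒟) {A B : 𝒞.Obj}
    (b : 𝒟.CharClass (φ.obj A) (φ.obj B))
    (hb : Module.finrank ℂ (𝒟.Hom (φ.obj A) (φ.obj B) ⧸ b.ker) = 1) :
    Module.finrank ℂ (𝒞.Hom A B ⧸ (b.pullback φ).ker) = 1 := by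
  induction b using Quotient.inductionOn with
  | h ω =>
    exact (CharClass.finrank_mk (ω.pullback φ)).2
      (φ.isMorphism.nondegenerate ω A B ((CharClass.finrank_mk ω).1 hb))

/-- The map `λ^φ : [ω]_{AB} ↦ [ω ∘ φ]_{AB}` on the spectra. -/
def SpecX.pullback (φ : 𝒞 ⟶ 𝒟) {A B : 𝒞.Obj} (p : 𝒟.SpecX (φ.obj A) (φ.obj B)) :
    𝒞.SpecX A B :=
  ⟨p.1.pullback φ, p.1.finrank_pullback φ p.2⟩

/-- The map `Λ^φ : x + ker(ω ∘ φ) ↦ φ(x) + ker ω` on the fibers. -/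
def specFibMap (φ : 𝒞 ⟶ 𝒟) {A B : 𝒞.Obj} (p : 𝒟.SpecX (φ.obj A) (φ.obj B)) :
    SpecFib (p.pullback φ) →ₗ[ℂ] SpecFib p :=
  Submodule.mapQ (p.pullback φ).1.ker p.1.ker φ.map (p.1.ker_pullback φ).le

/-- The morphism `Σ_φ = (λ^φ, Λ^φ) : Σ(𝒟) → Σ(𝒞)`. -/
@[reducible] def spectrumMap (φ : 𝒞 ⟶ 𝒟) : SpaceoidData.Mor 𝒟.spectrum 𝒞.spectrum where
  obj := φ.obj
  base p := p.pullback φ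
  fibMap p := specFibMap φ p

/-! ### The endofunctor `Γ ∘ Σ` and the Gel'fand transform -/

/-- `Γ(Σ(𝒞))` as an object of the category of small commutative C*-categories. -/
@[reducible] def gammaSpectrum (𝒞 : CommCStarCat.{u}) (hΓ : 𝒞.spectrum.SectionsClosed)
    (hΓC : (𝒞.spectrum.Gamma hΓ).IsCommCStarCat) : CommCStarCat.{u} :=
  { 𝒞.spectrum.Gamma hΓ with isComm := hΓC }

theorem Mor.ext_of_heq {𝒞 𝒟 : CommCStarCat.{u}} {φ ψ : 𝒞.Mor 𝒟} (h : φ.obj = ψ.obj)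
    (hm : ∀ (A B : 𝒞.Obj) (x : 𝒞.Hom A B), HEq (φ.map x) (ψ.map x)) : φ = ψ := by
  obtain ⟨⟨o, m⟩, _⟩ := φ
  obtain ⟨⟨o', m'⟩, _⟩ := ψ
  obtain rfl : o = o' := h
  have : @m = @m' := by
    funext A B
    exact LinearMap.ext fun x => eq_of_heq (hm A B x)
  subst this
  rfl

theorem specFibMap_id {A B : 𝒞.Obj} (σ : ∀ p : 𝒞.SpecX A B, SpecFib p) (p : 𝒞.SpecX A B) :
    specFibMap (A := A) (B := B) (𝟙 𝒞) p (σ (SpecX.pullback (A := A) (B := B) (𝟙 𝒞) p)) =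
      σ p := by
  obtain ⟨b, hb⟩ := p
  induction b using Quotient.inductionOn with
  | h ω =>
    have key : ∀ e : SpecFib (A := A) (B := B) ⟨Quotient.mk _ ω, hb⟩,
        specFibMap (A := A) (B := B) (𝟙 𝒞) ⟨Quotient.mk _ ω, hb⟩ e = e := by
      intro e
      obtain ⟨x, rfl⟩ : ∃ x, SpecFib.mk _ x = e := Submodule.mkQ_surjective _ _
      rfl
    exact key _

theorem specFibMap_comp {𝒞 𝒟 ℰ : CommCStarCat.{u}} (φ : 𝒞 ⟶ 𝒟) (ψ : 𝒟 ⟶ ℰ) {A B : 𝒞.Obj}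
    (σ : ∀ p : 𝒞.SpecX A B, SpecFib p) (p : ℰ.SpecX (ψ.obj (φ.obj A)) (ψ.obj (φ.obj B))) :
    specFibMap (A := A) (B := B) (φ ≫ ψ) p
        (σ (SpecX.pullback (A := A) (B := B) (φ ≫ ψ) p)) =
      specFibMap ψ p (specFibMap φ (p.pullback ψ) (σ ((p.pullback ψ).pullback φ))) := by
  obtain ⟨b, hb⟩ := p
  induction b using Quotient.inductionOn with
  | h ω =>
    have key : ∀ e : SpecFib (SpecX.pullback φ (SpecX.pullback ψ ⟨Quotient.mk _ ω, hb⟩)),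
        specFibMap (A := A) (B := B) (φ ≫ ψ) ⟨Quotient.mk _ ω, hb⟩ e =
          specFibMap ψ _ (specFibMap φ _ e) := by
      intro e
      obtain ⟨x, rfl⟩ : ∃ x, SpecFib.mk _ x = e := Submodule.mkQ_surjective _ _
      rfl
    exact key _

/-- The endofunctor `Γ ∘ Σ`, given that it is well defined on objects and morphisms. -/
def gammaSpectrumFunctor
    (hΓ : ∀ 𝒞 : CommCStarCat.{u}, 𝒞.spectrum.SectionsClosed)
    (hΓC : ∀ 𝒞 : CommCStarCat.{u}, (𝒞.spectrum.Gamma (hΓ 𝒞)).IsCommCStarCat)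
    (hmem : ∀ {𝒞 𝒟 : CommCStarCat.{u}} (φ : 𝒞 ⟶ 𝒟) {A B : 𝒞.Obj}
      {σ : 𝒞.spectrum.Section A B}, σ.IsC0 → ((spectrumMap φ).pullSection σ).IsC0)
    (hmor : ∀ {𝒞 𝒟 : CommCStarCat.{u}} (φ : 𝒞 ⟶ 𝒟),
      ((spectrumMap φ).Gamma (hΓ 𝒟) (hΓ 𝒞) (hmem φ)).IsMorphism) :
    CommCStarCat.{u} ⥤ CommCStarCat.{u} where
  obj 𝒞 := 𝒞.gammaSpectrum (hΓ 𝒞) (hΓC 𝒞)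
  map φ := ⟨(spectrumMap φ).Gamma (hΓ _) (hΓ _) (hmem φ), hmor φ⟩
  map_id 𝒞 := Mor.ext_of_heq rfl fun A B σ =>
    heq_of_eq (Subtype.ext (funext (specFibMap_id (𝒞 := 𝒞) (A := A) (B := B) σ.1)))
  map_comp φ ψ := Mor.ext_of_heq rfl fun A B σ =>
    heq_of_eq (Subtype.ext (funext (specFibMap_comp φ ψ (A := A) (B := B) σ.1)))

/-- The Gel'fand transform `𝔊_𝒞 : 𝒞 → Γ(Σ(𝒞))`, `A ↦ A`, `x ↦ x̂`. -/
def gelfand (𝒞 : CommCStarCat.{u}) (hΓ : 𝒞.spectrum.SectionsClosed)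
    (hx : ∀ {A B : 𝒞.Obj} (x : 𝒞.Hom A B),
      SpaceoidData.Section.IsC0 (𝓔 := 𝒞.spectrum) (gelfandSection x)) :
    𝒞.LinFunctor (𝒞.spectrum.Gamma hΓ) where
  obj := id
  map :=
    { toFun := fun x => ⟨gelfandSection x, hx x⟩
      map_add' := fun x y => Subtype.ext (funext fun p => (SpecFib.mk p).map_add x y)
      map_smul' := fun a x => Subtype.ext (funext fun p => (SpecFib.mk p).map_smul a x) }

end CommCStarCat

end

/-! Everything rests on classical Gel'fand duality for the commutative unital C*-algebras 𝒞_{AA},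
together with two facts that reduce the other Hom-sets to the diagonal.

Every character χ of 𝒞_{AA} extends to 𝒞 (`extendChar`): for each B choose x_B in 𝒞_{BA} with χ(x_B*
x_B) = 1 if there is one, x_B = 0 otherwise, and send y in 𝒞_{BC} to χ(x_B* y x_C). Hence 𝒳_{AA} is
the Gel'fand spectrum of 𝒞_{AA}. Next, the form (x, y) ↦ ω(x) ω(y)* = ω(x y*) determines ω on 𝒞_{AB}
up to a phase, so a point of 𝒳_{AB} is determined by its target. The space of classes is compact,
hence it carries the topology of pointwise convergence of forms
(`CharClass.isClosedEmbedding_form`), and 𝒳_{AB} becomes the open subset of 𝒳_{AA} on which some x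
x* does not vanish. The remaining points of 𝒳_{AA} are harmless: every x x* is zero there.

From ‖x‖² = ‖x x*‖ it follows that ‖x‖ is the supremum of |ω(x)| over 𝒳_{AB}. Truncating x by an
element of 𝒞_{AA} shows that the quotient norm of x + ker ω is |ω(x)| (`SpecFib.norm_mk`), so x ↦ x̂
is isometric. The tubular topology is induced by the projection and by the phase-free pairings of e
= x + ker ω with y, of value ω(x) ω(y)* (`isInducing_total`); continuity of all bundle operations
then follows from quotient formulas for complex functions.

For surjectivity, a C₀-section is approximated locally by transforms, and these are glued by a
partition of unity on 𝒳_{AA} whose functions come from 𝒞_{AA} (`exists_norm_sub_mk_le`);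
completeness of 𝒞_{AB} gives the limit. Since every section is some x̂, closure of Γ(Σ(𝒞)) under its
operations, its axioms, and the properties of Γ_{Σ_φ} are transported from 𝒞. Naturality is the
definition of Λ^φ on cosets. -/

noncomputable section

namespace CommCStarCat

/-! ### Elementary consequences of the axioms -/

section Basic

variable {𝒞 : CommCStarCat.{u}} {A B C D : 𝒞.Obj}

theorem zero_comp (y : 𝒞.Hom B C) : 𝒞.comp (0 : 𝒞.Hom A B) y = 0 := by
  have h := 𝒞.isComm.smul_comp (0 : ℂ) (0 : 𝒞.Hom A B) y
  rwa [zero_smul, zero_smul] at h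

theorem comp_zero (x : 𝒞.Hom A B) : 𝒞.comp x (0 : 𝒞.Hom B C) = 0 := by
  have h := 𝒞.isComm.comp_smul (0 : ℂ) x (0 : 𝒞.Hom B C)
  rwa [zero_smul, zero_smul] at h

/-- ‖x‖² = ‖x* x‖ ≤ ‖x*‖ ‖x‖ gives one inequality after cancelling ‖x‖; the other is the same for
x*. -/
theorem norm_star (x : 𝒞.Hom A B) : ‖𝒞.star x‖ = ‖x‖ := by
  have key : ∀ {A B : 𝒞.Obj} (x : 𝒞.Hom A B), ‖x‖ ≤ ‖𝒞.star x‖ := by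
    intro A B x
    by_cases h0 : ‖x‖ = 0
    · rw [h0]; exact norm_nonneg _
    · have h1 := 𝒞.isComm.norm_comp_le (𝒞.star x) x
      rw [𝒞.isComm.norm_star_comp_self, sq] at h1
      exact le_of_mul_le_mul_right h1 (lt_of_le_of_ne (norm_nonneg _) (Ne.symm h0))
  refine le_antisymm ?_ (key x)
  simpa only [𝒞.isComm.star_star] using key (𝒞.star x)

theorem norm_comp_star_self (x : 𝒞.Hom A B) : ‖𝒞.comp x (𝒞.star x)‖ = ‖x‖ ^ 2 := by
  have h := 𝒞.isComm.norm_star_comp_self (𝒞.star x)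
  rwa [𝒞.isComm.star_star, norm_star] at h

end Basic

/-! ### The diagonal C*-algebras and the extension of their characters -/

section Diagonal

variable (𝒞 : CommCStarCat.{u})

/-- The commutative C*-algebra `𝒞_{AA}`. -/
def EndAlg (A : 𝒞.Obj) : Type u := 𝒞.Hom A A

variable {𝒞} in
/-- An endomorphism as an element of the algebra `𝒞_{AA}`. -/
def toEnd {A : 𝒞.Obj} (x : 𝒞.Hom A A) : 𝒞.EndAlg A := x

variable {𝒞} in
/-- An element of the algebra `𝒞_{AA}` as an endomorphism. -/
def ofEnd {A : 𝒞.Obj} (x : 𝒞.EndAlg A) : 𝒞.Hom A A := x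

instance (A : 𝒞.Obj) : NormedAddCommGroup (𝒞.EndAlg A) :=
  inferInstanceAs (NormedAddCommGroup (𝒞.Hom A A))

instance (A : 𝒞.Obj) : NormedSpace ℂ (𝒞.EndAlg A) :=
  inferInstanceAs (NormedSpace ℂ (𝒞.Hom A A))

instance (A : 𝒞.Obj) : CommRing (𝒞.EndAlg A) :=
  { (inferInstance : AddCommGroup (𝒞.EndAlg A)) with
    mul := fun x y => 𝒞.comp (ofEnd x) (ofEnd y)
    one := 𝒞.one A
    mul_assoc := fun x y z => 𝒞.isComm.comp_assoc (ofEnd x) (ofEnd y) (ofEnd z)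
    one_mul := fun x => 𝒞.isComm.one_comp (ofEnd x)
    mul_one := fun x => 𝒞.isComm.comp_one (ofEnd x)
    left_distrib := fun x y z => 𝒞.isComm.comp_add (ofEnd x) (ofEnd y) (ofEnd z)
    right_distrib := fun x y z => 𝒞.isComm.add_comp (ofEnd x) (ofEnd y) (ofEnd z)
    zero_mul := fun x => zero_comp (ofEnd x)
    mul_zero := fun x => comp_zero (ofEnd x)
    mul_comm := fun x y => 𝒞.isComm.comm (ofEnd x) (ofEnd y) }

instance (A : 𝒞.Obj) : NormedCommRing (𝒞.EndAlg A) :=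
  { (inferInstance : NormedAddCommGroup (𝒞.EndAlg A)),
    (inferInstance : CommRing (𝒞.EndAlg A)) with
    norm_mul_le := fun x y => 𝒞.isComm.norm_comp_le (ofEnd x) (ofEnd y) }

instance (A : 𝒞.Obj) : Algebra ℂ (𝒞.EndAlg A) :=
  Algebra.ofModule (fun a x y => 𝒞.isComm.smul_comp a (ofEnd x) (ofEnd y))
    (fun a x y => 𝒞.isComm.comp_smul a (ofEnd x) (ofEnd y))

instance (A : 𝒞.Obj) : NormedAlgebra ℂ (𝒞.EndAlg A) where
  norm_smul_le a x := (norm_smul a x).le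

instance (A : 𝒞.Obj) : StarRing (𝒞.EndAlg A) where
  star x := 𝒞.star (ofEnd x)
  star_involutive x := 𝒞.isComm.star_star (ofEnd x)
  star_mul x y := 𝒞.isComm.star_comp (ofEnd x) (ofEnd y)
  star_add x y := 𝒞.isComm.star_add (ofEnd x) (ofEnd y)

instance (A : 𝒞.Obj) : StarModule ℂ (𝒞.EndAlg A) where
  star_smul a x := 𝒞.isComm.star_smul a (ofEnd x)

instance (A : 𝒞.Obj) : CompleteSpace (𝒞.EndAlg A) := 𝒞.isComm.complete A A

instance (A : 𝒞.Obj) : CStarRing (𝒞.EndAlg A) where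
  norm_mul_self_le x := by
    have h := 𝒞.isComm.norm_star_comp_self (ofEnd x)
    rw [sq] at h
    exact h.ge

instance (A : 𝒞.Obj) : CommCStarAlgebra (𝒞.EndAlg A) where

variable {𝒞}

/-- A character of `𝒞_{AA}`, evaluated at an endomorphism. -/
def charApp {A : 𝒞.Obj} (χ : WeakDual.characterSpace ℂ (𝒞.EndAlg A)) (c : 𝒞.Hom A A) : ℂ :=
  χ (toEnd c)

variable {A : 𝒞.Obj} (χ : WeakDual.characterSpace ℂ (𝒞.EndAlg A))

theorem charApp_comp (c d : 𝒞.Hom A A) :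
    charApp χ (𝒞.comp c d) = charApp χ c * charApp χ d :=
  map_mul χ (toEnd c) (toEnd d)

theorem charApp_star (c : 𝒞.Hom A A) :
    charApp χ (𝒞.star c) = (starRingEnd ℂ) (charApp χ c) :=
  map_star χ (toEnd c)

theorem charApp_one : charApp χ (𝒞.one A) = 1 := map_one χ

theorem charApp_add (c d : 𝒞.Hom A A) : charApp χ (c + d) = charApp χ c + charApp χ d :=
  map_add χ (toEnd c) (toEnd d)

theorem charApp_smul (a : ℂ) (c : 𝒞.Hom A A) : charApp χ (a • c) = a * charApp χ c :=
  map_smul χ a (toEnd c)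

theorem charApp_zero : charApp χ 0 = 0 := map_zero χ

/-- The positivity axiom enters here: χ(w* w) = |χ(y)|² is positive. Scaling w by a multiplies the
value by |a|², so only a positive value can be normalised to 1. -/
theorem exists_charApp_eq_one {B : 𝒞.Obj} (w : 𝒞.Hom B A)
    (hw : charApp χ (𝒞.comp (𝒞.star w) w) ≠ 0) :
    ∃ x : 𝒞.Hom B A, charApp χ (𝒞.comp (𝒞.star x) x) = 1 := by
  obtain ⟨y, hy⟩ := 𝒞.isComm.star_comp_self_pos w
  have h1 : charApp χ (𝒞.comp (𝒞.star w) w) = ((‖charApp χ y‖ : ℝ) : ℂ) ^ 2 := by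
    rw [hy, charApp_comp, charApp_star, mul_comm, Complex.mul_conj, Complex.normSq_eq_norm_sq]
    push_cast
    rfl
  have h2 : ((‖charApp χ y‖ : ℝ) : ℂ) ≠ 0 := fun h0 => hw (by rw [h1, h0]; simp)
  refine ⟨((‖charApp χ y‖ : ℝ) : ℂ)⁻¹ • w, ?_⟩
  rw [𝒞.isComm.star_smul, 𝒞.isComm.smul_comp, 𝒞.isComm.comp_smul, charApp_smul, charApp_smul, h1,
    map_inv₀, Complex.conj_ofReal]
  field_simp

open Classical in
/-- A morphism `x : B → A` with `χ(x* x) = 1` if there is one, and zero otherwise. -/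
def bridge (B : 𝒞.Obj) : 𝒞.Hom B A :=
  if h : ∃ x : 𝒞.Hom B A, charApp χ (𝒞.comp (𝒞.star x) x) = 1 then h.choose else 0

theorem bridge_spec (B : 𝒞.Obj) :
    charApp χ (𝒞.comp (𝒞.star (bridge χ B)) (bridge χ B)) = 1 ∨
      (bridge χ B = 0 ∧ ∀ w : 𝒞.Hom B A, charApp χ (𝒞.comp (𝒞.star w) w) = 0) := by
  by_cases h : ∃ x : 𝒞.Hom B A, charApp χ (𝒞.comp (𝒞.star x) x) = 1
  · left
    rw [bridge, dif_pos h]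
    exact h.choose_spec
  · right
    refine ⟨by rw [bridge, dif_neg h], fun w => ?_⟩
    by_contra hw
    exact h (exists_charApp_eq_one χ w hw)

/-- `χ(a x x* b) = χ(x* x) χ(a b)` if `χ(x* x) ≠ 0`. -/
theorem charApp_insert {C : 𝒞.Obj} (a : 𝒞.Hom A C) (x b : 𝒞.Hom C A)
    (hx : charApp χ (𝒞.comp (𝒞.star x) x) = 1) :
    charApp χ (𝒞.comp a x) * charApp χ (𝒞.comp (𝒞.star x) b) = charApp χ (𝒞.comp a b) := by
  have h1 : 𝒞.comp (𝒞.comp (𝒞.comp a x) (𝒞.comp (𝒞.star x) b)) (𝒞.comp (𝒞.star x) x) =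
      𝒞.comp (𝒞.comp (𝒞.comp a b) (𝒞.comp (𝒞.star x) x)) (𝒞.comp (𝒞.star x) x) := by
    -- Commutativity of 𝒞_{CC} turns x x* b x* into b x* x x*; the spare factors x* x have value 1
    -- under χ.
    have := 𝒞.isComm.comm (𝒞.comp x (𝒞.star x)) (𝒞.comp b (𝒞.star x))
    have h2 := congrArg (fun t => 𝒞.comp a (𝒞.comp t x)) this
    simpa only [𝒞.isComm.comp_assoc] using h2
  have h3 := congrArg (charApp χ) h1
  simpa only [charApp_comp, hx, mul_one] using h3

/-- The square of (ab)*(ab) contains a* a b b*, whose factors a* a and b b* commute in 𝒞_{CC};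
exchanging them splits off b* b. Hence |χ(ab)|⁴ = 0. -/
theorem charApp_comp_eq_zero {C : 𝒞.Obj} (a : 𝒞.Hom A C) (b : 𝒞.Hom C A)
    (hb : charApp χ (𝒞.comp (𝒞.star b) b) = 0) : charApp χ (𝒞.comp a b) = 0 := by
  have h1 : 𝒞.comp (𝒞.comp (𝒞.star (𝒞.comp a b)) (𝒞.comp a b))
      (𝒞.comp (𝒞.star (𝒞.comp a b)) (𝒞.comp a b)) =
      𝒞.comp (𝒞.comp (𝒞.star b) b) (𝒞.comp (𝒞.star b) (𝒞.comp (𝒞.comp (𝒞.star a) a)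
        (𝒞.comp (𝒞.comp (𝒞.star a) a) b))) := by
    have := 𝒞.isComm.comm (𝒞.comp (𝒞.star a) a) (𝒞.comp b (𝒞.star b))
    have h2 := congrArg
      (fun t => 𝒞.comp (𝒞.star b) (𝒞.comp t (𝒞.comp (𝒞.comp (𝒞.star a) a) b))) this
    simpa only [𝒞.isComm.star_comp, 𝒞.isComm.comp_assoc] using h2
  have h3 := congrArg (charApp χ) h1
  rw [charApp_comp χ (𝒞.comp (𝒞.star b) b), hb, zero_mul, charApp_comp, charApp_comp,
    charApp_star] at h3
  simpa using h3

/-- Every character of the algebra `𝒞_{AA}` extends to `𝒞`. -/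
def extendChar : 𝒞.Character where
  app B C :=
    { toFun := fun y => charApp χ (𝒞.comp (𝒞.star (bridge χ B)) (𝒞.comp y (bridge χ C)))
      map_add' := fun x y => by rw [𝒞.isComm.add_comp, 𝒞.isComm.comp_add, charApp_add]
      map_smul' := fun a x => by
        rw [𝒞.isComm.smul_comp, 𝒞.isComm.comp_smul, charApp_smul, RingHom.id_apply, smul_eq_mul] }
  map_comp {B C D} y z := by
    change charApp χ _ = charApp χ _ * charApp χ _
    -- If the middle object C has a normalised bridge x, inserting x x* between y and z does not
    -- change the value. Otherwise the right side is zero, and χ vanishes on every element of 𝒞_{AA}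
    -- that factors through C.
    rcases bridge_spec χ C with h | ⟨h0, h⟩
    · rw [← 𝒞.isComm.comp_assoc (𝒞.star (bridge χ B)) y, charApp_insert χ _ _ _ h]
      simp only [𝒞.isComm.comp_assoc]
    · rw [h0, comp_zero, comp_zero, charApp_zero, zero_mul, 𝒞.isComm.comp_assoc,
        ← 𝒞.isComm.comp_assoc]
      exact charApp_comp_eq_zero χ _ _ (h _)
  map_star {B C} y := by
    change charApp χ _ = (starRingEnd ℂ) (charApp χ _)
    rw [← charApp_star]
    simp only [𝒞.isComm.star_comp, 𝒞.isComm.star_star, 𝒞.isComm.comp_assoc]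

theorem extendChar_app (c : 𝒞.Hom A A) : (extendChar χ).app A A c = charApp χ c := by
  have h1 : charApp χ (𝒞.comp (𝒞.star (bridge χ A)) (bridge χ A)) = 1 := by
    -- The identity has χ(ι_A* ι_A) = 1, so A itself always has a normalised bridge.
    refine (bridge_spec χ A).resolve_right fun h => ?_
    have := h.2 (𝒞.one A)
    rw [𝒞.isComm.comp_one, 𝒞.isComm.star_one, charApp_one] at this
    exact one_ne_zero this
  change charApp χ (𝒞.comp (𝒞.star (bridge χ A)) (𝒞.comp c (bridge χ A))) = _
  rw [𝒞.isComm.comm c, ← 𝒞.isComm.comp_assoc, charApp_comp, h1, one_mul]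

end Diagonal

/-! ### Classes of characters and the groupoid structure of the spectrum -/

section Classes

variable {𝒞 : CommCStarCat.{u}} {A B C D : 𝒞.Obj}

theorem app_one_of_ne_left {ω : 𝒞.Character} (h : ∃ x, ω.app A B x ≠ 0) :
    ω.app A A (𝒞.one A) = 1 := by
  obtain ⟨x, hx⟩ := h
  have h1 := ω.map_comp (𝒞.one A) x
  rw [𝒞.isComm.one_comp] at h1
  exact mul_right_cancel₀ hx (by rw [one_mul, ← h1])

theorem app_comp_star (ω : 𝒞.Character) (x y : 𝒞.Hom A B) :
    ω.app A A (𝒞.comp x (𝒞.star y)) = ω.app A B x * (starRingEnd ℂ) (ω.app A B y) := by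
  rw [ω.map_comp, ω.map_star]

theorem app_star_comp (ω : 𝒞.Character) (x y : 𝒞.Hom A B) :
    ω.app B B (𝒞.comp (𝒞.star y) x) = ω.app A B x * (starRingEnd ℂ) (ω.app A B y) := by
  rw [ω.map_comp, ω.map_star, mul_comm]

/-- Two characters with the same sesquilinear form on `𝒞_{AB}` agree there up to a phase. -/
theorem charSetoid_of_form_eq {ω ρ : 𝒞.Character}
    (h : ∀ x y, ω.app A B x * (starRingEnd ℂ) (ω.app A B y) =
      ρ.app A B x * (starRingEnd ℂ) (ρ.app A B y)) : 𝒞.charSetoid A B ω ρ := by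
  have hn : ∀ x, ‖ω.app A B x‖ = ‖ρ.app A B x‖ := fun x => by
    have h1 := congrArg norm (h x x)
    rw [norm_mul, norm_mul, RCLike.norm_conj, RCLike.norm_conj] at h1
    exact (mul_self_inj (norm_nonneg _) (norm_nonneg _)).1 h1
  by_cases h0 : ∃ x, ω.app A B x ≠ 0
  · obtain ⟨x, hx⟩ := h0
    have hρ : ρ.app A B x ≠ 0 := norm_ne_zero_iff.1 (by rw [← hn]; exact norm_ne_zero_iff.2 hx)
    -- The phase is read off at one x with ω(x) ≠ 0; equality of the forms at (y, x) shows that it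
    -- serves for every y.
    refine ⟨⟨ρ.app A B x / ω.app A B x, mem_sphere_zero_iff_norm.2 ?_⟩, fun y => ?_⟩
    · rw [norm_div, hn, div_self (norm_ne_zero_iff.2 hρ)]
    · change ρ.app A B y = ρ.app A B x / ω.app A B x * ω.app A B y
      have hc : (starRingEnd ℂ) (ρ.app A B x) ≠ 0 := (map_ne_zero _).2 hρ
      refine mul_right_cancel₀ hc ?_
      rw [← h y x]
      have hxx := h x x
      field_simp
      linear_combination ω.app A B y * hxx
  · push Not at h0
    refine ⟨1, fun y => ?_⟩
    have := hn y
    rw [h0 y, norm_zero] at this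
    rw [h0 y, mul_zero]
    exact norm_eq_zero.1 this.symm

theorem form_eq_of_charSetoid {ω ρ : 𝒞.Character} (h : 𝒞.charSetoid A B ω ρ)
    (x y : 𝒞.Hom A B) : ω.app A B x * (starRingEnd ℂ) (ω.app A B y) =
      ρ.app A B x * (starRingEnd ℂ) (ρ.app A B y) := by
  obtain ⟨u, hu⟩ := h
  have h1 : (u : ℂ) * (starRingEnd ℂ) (u : ℂ) = 1 := by
    rw [Complex.mul_conj, Complex.normSq_eq_norm_sq, Circle.norm_coe]
    simp
  rw [hu, hu, map_mul]
  linear_combination (-ω.app A B x * (starRingEnd ℂ) (ω.app A B y)) * h1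

/-- ω(c) is the quotient of the form at (c x, x) by the form at (x, x), in which the phase cancels.
Without a non-zero value on 𝒞_{AB} the class retains nothing about 𝒞_{AA}. -/
theorem charSetoid_left {ω ρ : 𝒞.Character} (h0 : ∃ x, ω.app A B x ≠ 0)
    (h : 𝒞.charSetoid A B ω ρ) : ω.app A A = ρ.app A A := by
  obtain ⟨x, hx⟩ := h0
  ext c
  have h1 := form_eq_of_charSetoid h (𝒞.comp c x) x
  have h2 := form_eq_of_charSetoid h x x
  rw [ω.map_comp, ρ.map_comp, mul_assoc, mul_assoc, ← h2] at h1
  exact mul_right_cancel₀ (mul_ne_zero hx ((map_ne_zero _).2 hx)) h1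

theorem charSetoid_right {ω ρ : 𝒞.Character} (h0 : ∃ x, ω.app A B x ≠ 0)
    (h : 𝒞.charSetoid A B ω ρ) : ω.app B B = ρ.app B B := by
  obtain ⟨x, hx⟩ := h0
  ext c
  have h1 := form_eq_of_charSetoid h (𝒞.comp x c) x
  have h2 := form_eq_of_charSetoid h x x
  rw [ω.map_comp, ρ.map_comp, mul_right_comm, mul_right_comm (ρ.app A B x), ← h2] at h1
  exact mul_left_cancel₀ (mul_ne_zero hx ((map_ne_zero _).2 hx)) h1

/-- The form on 𝒞_{AB} is (x, y) ↦ ω(x y*), with x y* in 𝒞_{AA}. -/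
theorem charSetoid_of_left {ω ρ : 𝒞.Character} (B : 𝒞.Obj) (h : ω.app A A = ρ.app A A) :
    𝒞.charSetoid A B ω ρ :=
  charSetoid_of_form_eq fun x y => by rw [← app_comp_star, ← app_comp_star, h]

namespace SpecX

theorem mk_rep' (p : 𝒞.SpecX A B) : SpecX.mk p.rep p.rep_ne = p := Subtype.ext p.mk_rep

theorem rep_mk (ω : 𝒞.Character) (h : ∃ x, ω.app A B x ≠ 0) :
    𝒞.charSetoid A B (SpecX.mk ω h).rep ω :=
  Quotient.exact (SpecX.mk ω h).mk_rep

theorem mk_eq_iff_left {ω ρ : 𝒞.Character} (h : ∃ x, ω.app A B x ≠ 0)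
    (h' : ∃ x, ρ.app A B x ≠ 0) : SpecX.mk ω h = SpecX.mk ρ h' ↔ ω.app A A = ρ.app A A :=
  ⟨fun e => charSetoid_left h (Quotient.exact (congrArg Subtype.val e)),
    fun e => Subtype.ext (Quotient.sound (charSetoid_of_left B e))⟩

theorem rep_mk_left (ω : 𝒞.Character) (h : ∃ x, ω.app A B x ≠ 0) :
    (SpecX.mk ω h).rep.app A A = ω.app A A :=
  charSetoid_left (SpecX.rep_ne _) (rep_mk ω h)

theorem rep_mk_right (ω : 𝒞.Character) (h : ∃ x, ω.app A B x ≠ 0) :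
    (SpecX.mk ω h).rep.app B B = ω.app B B :=
  charSetoid_right (SpecX.rep_ne _) (rep_mk ω h)

/-- Representatives carry an arbitrary phase off the diagonal but none on it, so the groupoid
identities are checked through this criterion. -/
theorem eq_iff_left {p q : 𝒞.SpecX A B} : p = q ↔ p.rep.app A A = q.rep.app A A := by
  rw [← mk_eq_iff_left p.rep_ne q.rep_ne, mk_rep', mk_rep']

theorem rep_tgt (p : 𝒞.SpecX A B) : p.tgt.rep.app A A = p.rep.app A A := rep_mk_left _ _

theorem rep_src (p : 𝒞.SpecX A B) : p.src.rep.app B B = p.rep.app B B := rep_mk_left _ _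

theorem rep_inv_left (p : 𝒞.SpecX A B) : p.inv.rep.app B B = p.rep.app B B := rep_mk_left _ _

theorem rep_inv_right (p : 𝒞.SpecX A B) : p.inv.rep.app A A = p.rep.app A A := rep_mk_right _ _

theorem rep_of_src_eq_tgt {p : 𝒞.SpecX A B} {q : 𝒞.SpecX B C} (h : p.src = q.tgt) :
    p.rep.app B B = q.rep.app B B := by
  rw [← rep_src, h, rep_tgt]

theorem src_eq_tgt_iff {p : 𝒞.SpecX A B} {q : 𝒞.SpecX B C} :
    p.src = q.tgt ↔ p.rep.app B B = q.rep.app B B := by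
  rw [eq_iff_left, rep_src, rep_tgt]

theorem rep_comp_left {p : 𝒞.SpecX A B} {q : 𝒞.SpecX B C} (h : p.src = q.tgt) :
    (p.comp q h).rep.app A A = p.rep.app A A := rep_mk_left _ _

/-- The composite is represented by `p.rep`, which agrees with `q.rep` on 𝒞_{BC} up to a phase that
disappears on 𝒞_{CC}. -/
theorem rep_comp_right {p : 𝒞.SpecX A B} {q : 𝒞.SpecX B C} (h : p.src = q.tgt) :
    (p.comp q h).rep.app C C = q.rep.app C C := by
  refine (rep_mk_right _ _).trans (charSetoid_right ?_ (charSetoid_of_left C (rep_of_src_eq_tgt h)))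
  exact q.rep_ne.imp fun y hy h0 => hy ((rep_zero_iff h y).1 h0)

/-- The sesquilinear form `(x, y) ↦ ω(x) ω(y)*` of a class `[ω]_{AB}`. -/
def form (p : 𝒞.SpecX A B) (x y : 𝒞.Hom A B) : ℂ :=
  p.rep.app A B x * (starRingEnd ℂ) (p.rep.app A B y)

/-- The value `ω(c)` of a class `[ω]_{AB}` at `c ∈ 𝒞_{AA}`. -/
def evL (p : 𝒞.SpecX A B) (c : 𝒞.Hom A A) : ℂ := p.rep.app A A c

theorem form_mk (ω : 𝒞.Character) (h : ∃ x, ω.app A B x ≠ 0) (x y : 𝒞.Hom A B) :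
    (SpecX.mk ω h).form x y = ω.app A B x * (starRingEnd ℂ) (ω.app A B y) :=
  form_eq_of_charSetoid (rep_mk ω h) x y

theorem form_eq_evL (p : 𝒞.SpecX A B) (x y : 𝒞.Hom A B) :
    p.form x y = p.evL (𝒞.comp x (𝒞.star y)) := (app_comp_star _ _ _).symm

theorem evL_tgt (p : 𝒞.SpecX A B) (c : 𝒞.Hom A A) : p.tgt.evL c = p.evL c := by
  rw [evL, rep_tgt, evL]

theorem form_self_ne {p : 𝒞.SpecX A B} {x : 𝒞.Hom A B} :
    p.form x x ≠ 0 ↔ p.rep.app A B x ≠ 0 := by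
  rw [form, Ne, mul_eq_zero, map_eq_zero (starRingEnd ℂ), or_self]

theorem exists_form_ne (p : 𝒞.SpecX A B) : ∃ x, p.form x x ≠ 0 :=
  p.rep_ne.imp fun _ => form_self_ne.2

theorem norm_form_self (p : 𝒞.SpecX A B) (x : 𝒞.Hom A B) :
    ‖p.form x x‖ = ‖p.rep.app A B x‖ ^ 2 := by
  rw [form, norm_mul, RCLike.norm_conj, sq]

theorem evL_one (p : 𝒞.SpecX A B) : p.evL (𝒞.one A) = 1 := app_one_of_ne_left p.rep_ne

end SpecX

/-! ### The topology of the spectrum -/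

-- Tychonoff: by `norm_app_le` the characters lie in a product of discs of radius ‖x‖, and their
-- defining equations are closed conditions.
variable (𝒞) in
instance compactSpace_character : CompactSpace 𝒞.Character := by
  let Φ : 𝒞.Character → (Σ A, Σ B, 𝒞.Hom A B) → ℂ := fun ω x => ω.app x.1 x.2.1 x.2.2
  have hemb : IsInducing Φ := ⟨rfl⟩
  have hcl : IsClosed (Set.range Φ) := by
    have : Set.range Φ =
        {f | ∀ A B (x y : 𝒞.Hom A B), f ⟨A, B, x + y⟩ = f ⟨A, B, x⟩ + f ⟨A, B, y⟩} ∩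
        {f | ∀ A B (a : ℂ) (x : 𝒞.Hom A B), f ⟨A, B, a • x⟩ = a * f ⟨A, B, x⟩} ∩
        {f | ∀ A B C (x : 𝒞.Hom A B) (y : 𝒞.Hom B C),
          f ⟨A, C, 𝒞.comp x y⟩ = f ⟨A, B, x⟩ * f ⟨B, C, y⟩} ∩
        {f | ∀ A B (x : 𝒞.Hom A B), f ⟨B, A, 𝒞.star x⟩ = (starRingEnd ℂ) (f ⟨A, B, x⟩)} := by
      ext f
      constructor
      · rintro ⟨ω, rfl⟩
        exact ⟨⟨⟨fun A B x y => map_add (ω.app A B) x y, fun A B a x => map_smul (ω.app A B) a x⟩,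
          fun _ _ _ x y => ω.map_comp x y⟩, fun _ _ x => ω.map_star x⟩
      · rintro ⟨⟨⟨h1, h2⟩, h3⟩, h4⟩
        exact ⟨{ app := fun A B =>
                  { toFun := fun x => f ⟨A, B, x⟩, map_add' := h1 A B, map_smul' := h2 A B }
                 map_comp := h3 _ _ _
                 map_star := h4 _ _ }, rfl⟩
    rw [this]
    refine ((IsClosed.inter ?_ ?_).inter ?_).inter ?_ <;>
      simp only [Set.ofPred_forall] <;>
      repeat' first
        | refine isClosed_iInter fun _ => ?_
        | exact isClosed_eq (by fun_prop) (by fun_prop)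
  refine ⟨?_⟩
  rw [hemb.isCompact_iff, Set.image_univ]
  refine (isCompact_univ_pi fun x : (Σ A, Σ B, 𝒞.Hom A B) =>
    isCompact_closedBall (0 : ℂ) ‖x.2.2‖).of_isClosed_subset hcl ?_
  rintro _ ⟨ω, rfl⟩ x -
  exact mem_closedBall_zero_iff.2 (𝒞.norm_app_le ω x.2.2)

theorem continuous_app (x : 𝒞.Hom A B) :
    Continuous fun ω : 𝒞.Character => ω.app A B x :=
  (continuous_apply (A := fun _ : (Σ A, Σ B, 𝒞.Hom A B) => ℂ) ⟨A, B, x⟩).comp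
    (continuous_induced_dom
      (f := fun (ω : 𝒞.Character) (x : Σ A, Σ B, 𝒞.Hom A B) => ω.app x.1 x.2.1 x.2.2))

/-- The sesquilinear form of a class of characters. -/
def CharClass.form (b : 𝒞.CharClass A B) (z : 𝒞.Hom A B × 𝒞.Hom A B) : ℂ :=
  Quotient.lift
    (fun ω : 𝒞.Character => ω.app A B z.1 * (starRingEnd ℂ) (ω.app A B z.2))
    (fun _ _ h => form_eq_of_charSetoid h z.1 z.2) b

/-- A continuous injection from a quotient of a compact space into a Hausdorff space. It replaces
the quotient topology by pointwise convergence of forms. -/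
theorem CharClass.isClosedEmbedding_form :
    IsClosedEmbedding (CharClass.form : 𝒞.CharClass A B → _) := by
  refine Continuous.isClosedEmbedding ?_ ?_
  · refine continuous_pi fun z => continuous_quot_lift _ ?_
    exact (continuous_app z.1).mul (Complex.continuous_conj.comp (continuous_app z.2))
  · intro b b' h
    induction b, b' using Quotient.inductionOn₂ with
    | h ω ρ => exact Quotient.sound (charSetoid_of_form_eq fun x y => congrFun h (x, y))

/-! ### The spaces 𝒳_{AB} as open subsets of the compact Hausdorff spaces 𝒳_{AA} -/

namespace SpecX

theorem isEmbedding_form :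
    IsEmbedding fun (p : 𝒞.SpecX A B) (z : 𝒞.Hom A B × 𝒞.Hom A B) => p.form z.1 z.2 := by
  have h := CharClass.isClosedEmbedding_form.isEmbedding.comp
    (IsEmbedding.subtypeVal :
      IsEmbedding (Subtype.val : 𝒞.SpecX A B → 𝒞.CharClass A B))
  refine (congrArg (fun f => IsEmbedding f) (funext fun p => funext fun z => ?_)).mp h
  change CharClass.form p.1 z = _
  rw [← p.mk_rep]
  rfl

theorem continuous_form (x y : 𝒞.Hom A B) : Continuous fun p : 𝒞.SpecX A B => p.form x y :=
  (continuous_apply (x, y)).comp isEmbedding_form.continuous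

instance t2Space : T2Space (𝒞.SpecX A B) := isEmbedding_form.t2Space

theorem continuous_iff_form {Y : Type*} [TopologicalSpace Y] {f : Y → 𝒞.SpecX A B} :
    Continuous f ↔ ∀ x y, Continuous fun t => (f t).form x y := by
  rw [isEmbedding_form.continuous_iff, continuous_pi_iff]
  exact ⟨fun h x y => h (x, y), fun h z => h z.1 z.2⟩

/-- Near a point with ω(x) ≠ 0, the form of the target at (c, d) is the quotient of the forms at (c
x, d x) and at (x, x). -/
theorem continuous_tgt : Continuous (SpecX.tgt : 𝒞.SpecX A B → 𝒞.SpecX A A) := by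
  refine continuous_iff_form.2 fun c d => continuous_iff_continuousAt.2 fun p => ?_
  obtain ⟨x, hx⟩ := p.exists_form_ne
  have h1 : ContinuousAt (fun q : 𝒞.SpecX A B =>
      q.form (𝒞.comp c x) (𝒞.comp d x) / q.form x x) p :=
    (continuous_form _ _).continuousAt.div (continuous_form _ _).continuousAt hx
  refine h1.congr ?_
  filter_upwards [(continuous_form x x).continuousAt.eventually_ne hx] with q hq
  rw [div_eq_iff hq]
  simp only [form, rep_tgt, q.rep.map_comp, map_mul]
  ring

theorem continuous_src : Continuous (SpecX.src : 𝒞.SpecX A B → 𝒞.SpecX B B) := by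
  refine continuous_iff_form.2 fun c d => continuous_iff_continuousAt.2 fun p => ?_
  obtain ⟨x, hx⟩ := p.exists_form_ne
  have h1 : ContinuousAt (fun q : 𝒞.SpecX A B =>
      q.form (𝒞.comp x c) (𝒞.comp x d) / q.form x x) p :=
    (continuous_form _ _).continuousAt.div (continuous_form _ _).continuousAt hx
  refine h1.congr ?_
  filter_upwards [(continuous_form x x).continuousAt.eventually_ne hx] with q hq
  rw [div_eq_iff hq]
  simp only [form, rep_src, q.rep.map_comp, map_mul]
  ring

theorem continuous_evL_diag (c : 𝒞.Hom A A) : Continuous fun p : 𝒞.SpecX A A => p.evL c := by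
  refine (continuous_form c (𝒞.one A)).congr fun p => ?_
  have := p.evL_one
  rw [evL] at this
  rw [form, this, map_one, mul_one, evL]

theorem continuous_evL (c : 𝒞.Hom A A) : Continuous fun p : 𝒞.SpecX A B => p.evL c :=
  ((continuous_evL_diag c).comp continuous_tgt).congr fun p => p.evL_tgt c

/-- The embedding by forms factors through the target, because the form at (x, y) is the value at x
y*. -/
theorem isEmbedding_tgt : IsEmbedding (SpecX.tgt : 𝒞.SpecX A B → 𝒞.SpecX A A) := by
  refine IsEmbedding.of_comp continuous_tgt
    (g := fun P (z : 𝒞.Hom A B × 𝒞.Hom A B) => P.evL (𝒞.comp z.1 (𝒞.star z.2)))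
    (continuous_pi fun z => continuous_evL_diag _) ?_
  convert (isEmbedding_form : IsEmbedding fun (p : 𝒞.SpecX A B) z => p.form z.1 z.2) using 1
  funext p z
  rw [Function.comp_apply, evL_tgt, form_eq_evL]

theorem isEmbedding_src : IsEmbedding (SpecX.src : 𝒞.SpecX A B → 𝒞.SpecX B B) := by
  refine IsEmbedding.of_comp continuous_src
    (g := fun P (z : 𝒞.Hom A B × 𝒞.Hom A B) => P.evL (𝒞.comp (𝒞.star z.2) z.1))
    (continuous_pi fun z => continuous_evL_diag _) ?_
  convert (isEmbedding_form : IsEmbedding fun (p : 𝒞.SpecX A B) z => p.form z.1 z.2) using 1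
  funext p z
  rw [Function.comp_apply, evL, rep_src, form, app_star_comp]

/-- Since ω(x x*) = |ω(x)|², the right side says that ω is non-zero on 𝒞_{AB}, which is what a lift
to 𝒳_{AB} requires. -/
theorem mem_range_tgt {P : 𝒞.SpecX A A} :
    P ∈ Set.range (SpecX.tgt : 𝒞.SpecX A B → 𝒞.SpecX A A) ↔
      ∃ x : 𝒞.Hom A B, P.evL (𝒞.comp x (𝒞.star x)) ≠ 0 := by
  constructor
  · rintro ⟨p, rfl⟩
    exact p.exists_form_ne.imp fun x hx => by rwa [evL_tgt, ← form_eq_evL]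
  · rintro ⟨x, hx⟩
    have h : ∃ x, P.rep.app A B x ≠ 0 := ⟨x, fun h0 => hx (by
      rw [evL, app_comp_star, h0, zero_mul])⟩
    exact ⟨SpecX.mk P.rep h, eq_iff_left.2 (by rw [rep_tgt, rep_mk_left])⟩

theorem mem_range_src {P : 𝒞.SpecX B B} :
    P ∈ Set.range (SpecX.src : 𝒞.SpecX A B → 𝒞.SpecX B B) ↔
      ∃ x : 𝒞.Hom A B, P.evL (𝒞.comp (𝒞.star x) x) ≠ 0 := by
  constructor
  · rintro ⟨p, rfl⟩
    exact p.exists_form_ne.imp fun x hx => by rwa [evL, rep_src, app_star_comp]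
  · rintro ⟨x, hx⟩
    have h : ∃ x, P.rep.app A B x ≠ 0 := ⟨x, fun h0 => hx (by
      rw [evL, app_star_comp, h0, zero_mul])⟩
    exact ⟨SpecX.mk P.rep h, eq_iff_left.2 (by rw [rep_src, rep_mk_right])⟩

theorem isOpenEmbedding_tgt : IsOpenEmbedding (SpecX.tgt : 𝒞.SpecX A B → 𝒞.SpecX A A) := by
  refine ⟨isEmbedding_tgt, ?_⟩
  have : Set.range (SpecX.tgt : 𝒞.SpecX A B → 𝒞.SpecX A A) =
      ⋃ x : 𝒞.Hom A B, {P | P.evL (𝒞.comp x (𝒞.star x)) ≠ 0} := by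
    ext P
    rw [mem_range_tgt, Set.mem_iUnion]
    rfl
  rw [this]
  exact isOpen_iUnion fun x => isOpen_ne_fun (continuous_evL_diag _) continuous_const

theorem isOpenEmbedding_src : IsOpenEmbedding (SpecX.src : 𝒞.SpecX A B → 𝒞.SpecX B B) := by
  refine ⟨isEmbedding_src, ?_⟩
  have : Set.range (SpecX.src : 𝒞.SpecX A B → 𝒞.SpecX B B) =
      ⋃ x : 𝒞.Hom A B, {P | P.evL (𝒞.comp (𝒞.star x) x) ≠ 0} := by
    ext P
    rw [mem_range_src, Set.mem_iUnion]
    rfl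
  rw [this]
  exact isOpen_iUnion fun x => isOpen_ne_fun (continuous_evL_diag _) continuous_const

instance compactSpace_diag : CompactSpace (𝒞.SpecX A A) := by
  -- A character is non-zero on 𝒞_{AA} exactly when ω(ι_A) = 1, which is a closed condition.
  have : {b : 𝒞.CharClass A A | Module.finrank ℂ (𝒞.Hom A A ⧸ b.ker) = 1} =
      {b | b.form (𝒞.one A, 𝒞.one A) = 1} := by
    ext b
    induction b using Quotient.inductionOn with
    | h ω =>
      refine (CharClass.finrank_mk ω).trans ?_
      change _ ↔ ω.app A A (𝒞.one A) * (starRingEnd ℂ) (ω.app A A (𝒞.one A)) = 1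
      constructor
      · intro h
        rw [app_one_of_ne_left h, map_one, mul_one]
      · exact fun h => ⟨𝒞.one A, left_ne_zero_of_mul (h ▸ one_ne_zero)⟩
  refine isCompact_iff_compactSpace.1 (IsClosed.isCompact ?_)
  change IsClosed {b : 𝒞.CharClass A A | Module.finrank ℂ (𝒞.Hom A A ⧸ b.ker) = 1}
  rw [this]
  exact isClosed_eq ((continuous_apply _).comp CharClass.isClosedEmbedding_form.continuous)
    continuous_const

/-- A subset of `𝒳_{AB}` is compact if it consists of the points over a closed subset of
`𝒳_{AA}` that is contained in the open set of targets. -/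
theorem isCompact_preimage_tgt {s : Set (𝒞.SpecX A A)} (hs : IsClosed s)
    (h : s ⊆ Set.range (SpecX.tgt : 𝒞.SpecX A B → 𝒞.SpecX A A)) :
    IsCompact (SpecX.tgt ⁻¹' s : Set (𝒞.SpecX A B)) := by
  rw [isEmbedding_tgt.isInducing.isCompact_iff, Set.image_preimage_eq_of_subset h]
  exact hs.isCompact

end SpecX

variable (𝒞) in
theorem spectrum_isBaseSpaceoid : 𝒞.spectrum.IsBaseSpaceoid where
  tgt_diag p := SpecX.eq_iff_left.2 (SpecX.rep_tgt p)
  src_diag p := SpecX.eq_iff_left.2 (SpecX.rep_src p)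
  tgt_comp p q h := SpecX.eq_iff_left.2 (by
    rw [SpecX.rep_tgt, SpecX.rep_tgt, SpecX.rep_comp_left])
  src_comp p q h := SpecX.eq_iff_left.2 (by
    rw [SpecX.rep_src, SpecX.rep_src, SpecX.rep_comp_right])
  tgt_inv p := SpecX.eq_iff_left.2 (by
    rw [SpecX.rep_tgt, SpecX.rep_src, SpecX.rep_inv_left])
  src_inv p := SpecX.eq_iff_left.2 (by
    rw [SpecX.rep_tgt, SpecX.rep_src, SpecX.rep_inv_right])
  comp_assoc p q r h h' h₁ h₁' := SpecX.eq_iff_left.2 (by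
    rw [SpecX.rep_comp_left, SpecX.rep_comp_left, SpecX.rep_comp_left])
  tgt_id_comp p h := SpecX.eq_iff_left.2 (by
    rw [SpecX.rep_comp_left, SpecX.rep_tgt])
  comp_src_id p h := SpecX.eq_iff_left.2 (by rw [SpecX.rep_comp_left])
  comp_inv p h := SpecX.eq_iff_left.2 (by rw [SpecX.rep_comp_left, SpecX.rep_tgt])
  inv_comp p h := SpecX.eq_iff_left.2 (by
    rw [SpecX.rep_comp_left, SpecX.rep_inv_left, SpecX.rep_src])
  continuous_comp A B C := by
    refine SpecX.isEmbedding_tgt.continuous_iff.2 ?_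
    refine (SpecX.continuous_tgt.comp (continuous_fst.comp continuous_subtype_val)).congr ?_
    exact fun z => SpecX.eq_iff_left.2 (by
      simp only [Function.comp_apply]
      rw [SpecX.rep_tgt, SpecX.rep_tgt, SpecX.rep_comp_left])
  continuous_inv A B := by
    refine SpecX.isEmbedding_tgt.continuous_iff.2 (SpecX.continuous_src.congr ?_)
    exact fun z => SpecX.eq_iff_left.2 (by
      rw [Function.comp_apply, SpecX.rep_tgt, SpecX.rep_src, SpecX.rep_inv_left])
  compact_diag A := SpecX.compactSpace_diag
  t2_diag A := SpecX.t2Space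
  tgt_openEmbedding A B := SpecX.isOpenEmbedding_tgt
  src_openEmbedding A B := SpecX.isOpenEmbedding_src

end Classes

/-! ### Gel'fand duality for the diagonal algebras -/

section Duality

variable {𝒞 : CommCStarCat.{u}} {A B C D : 𝒞.Obj}

namespace SpecX

/-- The character of the algebra `𝒞_{AA}` given by a point of `𝒳_{AA}`. -/
def toChar (p : 𝒞.SpecX A A) : WeakDual.characterSpace ℂ (𝒞.EndAlg A) :=
  WeakDual.CharacterSpace.equivAlgHom.symm
    (AlgHom.ofLinearMap (R := ℂ) (A := 𝒞.EndAlg A) (B := ℂ)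
      (show 𝒞.EndAlg A →ₗ[ℂ] ℂ from p.rep.app A A) p.evL_one
      fun x y => p.rep.map_comp (ofEnd x) (ofEnd y))

theorem charApp_toChar (p : 𝒞.SpecX A A) (c : 𝒞.Hom A A) : charApp p.toChar c = p.evL c := rfl

/-- The point of `𝒳_{AA}` given by a character of the algebra `𝒞_{AA}`. -/
def ofChar (χ : WeakDual.characterSpace ℂ (𝒞.EndAlg A)) : 𝒞.SpecX A A :=
  SpecX.mk (extendChar χ) ⟨𝒞.one A, by rw [extendChar_app, charApp_one]; exact one_ne_zero⟩

theorem evL_ofChar (χ : WeakDual.characterSpace ℂ (𝒞.EndAlg A)) (c : 𝒞.Hom A A) :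
    (ofChar χ).evL c = charApp χ c := by
  rw [evL, ofChar, rep_mk_left, extendChar_app]

theorem ofChar_toChar (p : 𝒞.SpecX A A) : ofChar p.toChar = p := by
  rw [eq_iff_left]
  ext c
  exact (evL_ofChar _ c).trans (charApp_toChar p c)

theorem toChar_ofChar (χ : WeakDual.characterSpace ℂ (𝒞.EndAlg A)) : (ofChar χ).toChar = χ :=
  WeakDual.CharacterSpace.ext fun c => evL_ofChar χ c

theorem continuous_toChar : Continuous (toChar : 𝒞.SpecX A A → _) :=
  Continuous.subtype_mk (WeakDual.continuous_of_continuous_eval fun c =>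
    continuous_evL_diag (ofEnd c)) _

variable (𝒞 A) in
/-- `𝒳_{AA}` is the Gel'fand spectrum of the algebra `𝒞_{AA}`. -/
def charHomeomorph : 𝒞.SpecX A A ≃ₜ WeakDual.characterSpace ℂ (𝒞.EndAlg A) :=
  Continuous.homeoOfEquivCompactToT2 (f := ⟨toChar, ofChar, ofChar_toChar, toChar_ofChar⟩)
    continuous_toChar

theorem norm_le_of_evL_le {c : 𝒞.Hom A A} {M : ℝ} (hM : 0 ≤ M)
    (h : ∀ p : 𝒞.SpecX A A, ‖p.evL c‖ ≤ M) : ‖c‖ ≤ M := by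
  have h1 : ‖WeakDual.gelfandTransform ℂ (𝒞.EndAlg A) (toEnd c)‖ = ‖toEnd c‖ :=
    (gelfandTransform_isometry (𝒞.EndAlg A)).norm_map_of_map_zero (map_zero _) _
  change ‖toEnd c‖ ≤ M
  rw [← h1, ContinuousMap.norm_le _ hM]
  intro χ
  change ‖charApp χ c‖ ≤ M
  rw [← evL_ofChar]
  exact h _

/-- Surjectivity of the Gel'fand transform of 𝒞_{AA}. It supplies the cut-offs that truncate
morphisms and the partitions of unity that glue them. -/
theorem exists_evL_eq (f : C(𝒞.SpecX A A, ℂ)) : ∃ a : 𝒞.Hom A A, ∀ p, p.evL a = f p := by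
  obtain ⟨a, ha⟩ := (gelfandStarTransform (𝒞.EndAlg A)).surjective
    (f.comp (charHomeomorph 𝒞 A).symm)
  refine ⟨ofEnd a, fun p => ?_⟩
  have h1 := congrArg (fun g => g (charHomeomorph 𝒞 A p)) ha
  simp only [ContinuousMap.comp_apply, ContinuousMap.coe_coe, Homeomorph.symm_apply_apply] at h1
  exact h1

theorem evL_eq_of_tgt (p : 𝒞.SpecX A B) (a : 𝒞.Hom A A) (x : 𝒞.Hom A B) :
    p.rep.app A B (𝒞.comp a x) = p.tgt.evL a * p.rep.app A B x := by
  rw [evL_tgt, evL, p.rep.map_comp]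

/-- Gel'fand isometry for the Hom-sets. -/
theorem norm_le_of_rep_le {x : 𝒞.Hom A B} {M : ℝ} (hM : 0 ≤ M)
    (h : ∀ p : 𝒞.SpecX A B, ‖p.rep.app A B x‖ ≤ M) : ‖x‖ ≤ M := by
  -- ‖x‖² = ‖x x*‖ moves the estimate to 𝒞_{AA}; points of 𝒳_{AA} that are not targets contribute
  -- zero.
  rw [← sq_le_sq₀ (norm_nonneg _) hM, ← norm_comp_star_self]
  refine norm_le_of_evL_le (by positivity) fun P => ?_
  by_cases h0 : ∃ x : 𝒞.Hom A B, P.evL (𝒞.comp x (𝒞.star x)) ≠ 0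
  · obtain ⟨p, rfl⟩ := mem_range_tgt.2 h0
    rw [evL_tgt, ← form_eq_evL, norm_form_self]
    exact (sq_le_sq₀ (norm_nonneg _) hM).2 (h p)
  · push Not at h0
    rw [h0, norm_zero]
    positivity

/-- For `p = [ω]_{AB}` there is `a ∈ 𝒞_{AA}` with `ω(a) = 1` and `‖a x‖ ≤ |ω(x)|`. -/
theorem exists_norm_comp_le (p : 𝒞.SpecX A B) (x : 𝒞.Hom A B) (hx : p.rep.app A B x ≠ 0) :
    ∃ a : 𝒞.Hom A A, p.evL a = 1 ∧ ‖𝒞.comp a x‖ ≤ ‖p.rep.app A B x‖ := by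
  set t := ‖p.rep.app A B x‖ ^ 2 with ht
  have ht0 : 0 < t := by positivity
  -- The cut-off is 1 where |P(x x*)| ≤ t, in particular at the target of p, and t / |P(x x*)|
  -- elsewhere; the maximum is at least t > 0.
  have hcont : Continuous fun P : 𝒞.SpecX A A =>
      ((t / max t ‖P.evL (𝒞.comp x (𝒞.star x))‖ : ℝ) : ℂ) :=
    Complex.continuous_ofReal.comp (continuous_const.div
      (continuous_const.max (continuous_evL_diag _).norm)
      fun P => (lt_max_of_lt_left ht0).ne')
  obtain ⟨a, ha⟩ := exists_evL_eq ⟨_, hcont⟩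
  simp only [ContinuousMap.coe_mk] at ha
  refine ⟨a, ?_, norm_le_of_rep_le (norm_nonneg _) fun q => ?_⟩
  · rw [← evL_tgt, ha, evL_tgt, ← form_eq_evL, norm_form_self, ← ht, max_self, div_self ht0.ne',
      Complex.ofReal_one]
  · rw [evL_eq_of_tgt, ha, norm_mul, Complex.norm_real, evL_tgt, ← form_eq_evL, norm_form_self]
    set s := ‖q.rep.app A B x‖ with hs
    have hs0 : 0 ≤ s := norm_nonneg _
    have hm : 0 < max t (s ^ 2) := lt_max_of_lt_left ht0
    have h1 : t ≤ max t (s ^ 2) := le_max_left _ _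
    have h2 : s ^ 2 ≤ max t (s ^ 2) := le_max_right _ _
    rw [Real.norm_of_nonneg (by positivity), ← sq_le_sq₀ (by positivity) (norm_nonneg _), ← ht,
      mul_pow, div_pow, div_mul_eq_mul_div, div_le_iff₀ (by positivity)]
    calc t ^ 2 * s ^ 2 = t * (t * s ^ 2) := by ring
      _ ≤ t * (max t (s ^ 2) * max t (s ^ 2)) := by gcongr
      _ = t * max t (s ^ 2) ^ 2 := by ring

end SpecX

/-! ### The fibers of the spectral bundle -/

namespace SpecFib

theorem mk_surjective (p : 𝒞.SpecX A B) : Function.Surjective (SpecFib.mk p) :=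
  Submodule.mkQ_surjective _

theorem mk_eq_mk_iff (p : 𝒞.SpecX A B) {x y : 𝒞.Hom A B} :
    SpecFib.mk p x = SpecFib.mk p y ↔ p.rep.app A B x = p.rep.app A B y := by
  rw [← sub_eq_zero (a := p.rep.app A B x), ← map_sub, ← p.mem_ker]
  exact Submodule.Quotient.eq _

/-- Contractivity of characters bounds the quotient norm from below; the truncated representative a
x of `exists_norm_comp_le` attains the bound. -/
theorem norm_mk (p : 𝒞.SpecX A B) (x : 𝒞.Hom A B) :
    ‖SpecFib.mk p x‖ = ‖p.rep.app A B x‖ := by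
  refine le_antisymm ?_ (le_of_forall_pos_le_add fun ε hε => ?_)
  · by_cases hx : p.rep.app A B x = 0
    · have : SpecFib.mk p x = SpecFib.mk p 0 := (mk_eq_mk_iff p).2 (by rw [hx, map_zero])
      rw [this, map_zero, norm_zero]
      exact norm_nonneg _
    · obtain ⟨a, ha, hax⟩ := p.exists_norm_comp_le x hx
      have : SpecFib.mk p x = SpecFib.mk p (𝒞.comp a x) := (mk_eq_mk_iff p).2 (by
        rw [SpecX.evL_eq_of_tgt, SpecX.evL_tgt, ha, one_mul])
      rw [this]
      exact (Submodule.Quotient.norm_mk_le p.1.ker _).trans hax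
  · obtain ⟨m, hm, hlt⟩ := Submodule.Quotient.norm_mk_lt (S := p.1.ker) (SpecFib.mk p x) hε
    have h1 : p.rep.app A B m = p.rep.app A B x := (mk_eq_mk_iff p).1 hm
    rw [← h1]
    exact (𝒞.norm_app_le _ _).trans hlt.le

/-- The pairing `(x + ker ω, y) ↦ ω(x) ω(y)*`. -/
def pair (p : 𝒞.SpecX A B) (y : 𝒞.Hom A B) : SpecFib p →ₗ[ℂ] ℂ :=
  p.1.ker.liftQ ((starRingEnd ℂ) (p.rep.app A B y) • p.rep.app A B) fun x hx => by
    rw [LinearMap.mem_ker, LinearMap.smul_apply, (p.mem_ker x).1 hx, smul_zero]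

theorem pair_mk (p : 𝒞.SpecX A B) (x y : 𝒞.Hom A B) : pair p y (SpecFib.mk p x) = p.form x y :=
  mul_comm _ _

theorem norm_pair (p : 𝒞.SpecX A B) (y : 𝒞.Hom A B) (e : SpecFib p) :
    ‖pair p y e‖ = ‖e‖ * ‖p.rep.app A B y‖ := by
  obtain ⟨x, rfl⟩ := mk_surjective p e
  rw [pair_mk, SpecX.form, norm_mul, RCLike.norm_conj, norm_mk]

theorem norm_eq_div (p : 𝒞.SpecX A B) (y : 𝒞.Hom A B) (hy : p.form y y ≠ 0) (e : SpecFib p) :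
    ‖e‖ = ‖pair p y e‖ / √‖p.form y y‖ := by
  rw [norm_pair, SpecX.norm_form_self, Real.sqrt_sq (norm_nonneg _),
    mul_div_cancel_right₀ _ (norm_ne_zero_iff.2 (SpecX.form_self_ne.1 hy))]

/-- The existential makes a tube a union of open conditions on the pairings. A y with ω(y) = 0 never
satisfies the inequality; any other y works. -/
theorem norm_lt_iff (p : 𝒞.SpecX A B) (e : SpecFib p) (ε : ℝ) :
    ‖e‖ < ε ↔ ∃ y, ‖pair p y e‖ < ε * √‖p.form y y‖ := by
  simp only [norm_pair, SpecX.norm_form_self, Real.sqrt_sq (norm_nonneg _)]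
  constructor
  · intro h
    obtain ⟨y, hy⟩ := p.rep_ne
    exact ⟨y, mul_lt_mul_of_pos_right h (norm_pos_iff.2 hy)⟩
  · rintro ⟨y, hy⟩
    exact lt_of_mul_lt_mul_right hy (norm_nonneg _)

end SpecFib

/-! ### The tubular topology -/

instance (A B : 𝒞.Obj) :
    TopologicalSpace (Bundle.TotalSpace ℂ (fun p : 𝒞.SpecX A B => SpecFib p)) :=
  𝒞.tubularTopology A B

/-- A tube around a Gel'fand transform. -/
def tube (x : 𝒞.Hom A B) (ε : ℝ) (O : Set (𝒞.SpecX A B)) : Set (𝒞.spectrum.Total A B) :=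
  {e | e.proj ∈ O ∧ ‖(show SpecFib e.proj from e.snd) - SpecFib.mk e.proj x‖ < ε}

theorem isOpen_tube (x : 𝒞.Hom A B) {ε : ℝ} (hε : 0 < ε) {O : Set (𝒞.SpecX A B)}
    (hO : IsOpen O) : IsOpen (tube x ε O) :=
  TopologicalSpace.isOpen_generateFrom_of_mem ⟨x, ε, O, hε, hO, rfl⟩

/-- The pairing on the total space. -/
def totalPair (y : 𝒞.Hom A B) (e : 𝒞.spectrum.Total A B) : ℂ := SpecFib.pair e.proj y e.snd

theorem totalPair_pt (y : 𝒞.Hom A B) {p : 𝒞.SpecX A B} (e : SpecFib p) :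
    totalPair y (𝒞.spectrum.pt e) = SpecFib.pair p y e := rfl

theorem continuous_proj : Continuous fun e : 𝒞.spectrum.Total A B => e.proj := by
  refine continuous_def.2 fun O hO => isOpen_iff_forall_mem_open.2 fun e he => ?_
  -- The tube about the zero section is made wide enough to contain e.
  refine ⟨tube 0 (‖(show SpecFib e.proj from e.snd)‖ + 1) O, fun _ h => h.1,
    isOpen_tube 0 (by positivity) hO, he, ?_⟩
  rw [map_zero, sub_zero]
  exact lt_add_one _

theorem continuous_totalPair (y : 𝒞.Hom A B) :
    Continuous (totalPair y : 𝒞.spectrum.Total A B → ℂ) := by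
  refine continuous_iff_continuousAt.2 fun e₀ => Metric.continuousAt_iff'.2 fun ε hε => ?_
  obtain ⟨p₀, e₀⟩ := e₀
  obtain ⟨z, rfl⟩ := SpecFib.mk_surjective p₀ e₀
  have hO : IsOpen {p : 𝒞.SpecX A B | dist (p.form z y) (p₀.form z y) < ε / 2} :=
    isOpen_lt ((SpecX.continuous_form z y).dist continuous_const) continuous_const
  -- The bound ‖pair p y e‖ ≤ ‖e‖ ‖y‖ is used with ‖y‖ + 1, which stays positive when y = 0.
  have hδ : 0 < ε / (2 * (‖y‖ + 1)) := by positivity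
  refine Filter.mem_of_superset ((isOpen_tube z hδ hO).mem_nhds ⟨?_, ?_⟩) ?_
  · simpa using half_pos hε
  · simpa using hδ
  · rintro ⟨p, e⟩ ⟨h1, h2⟩
    change dist (SpecFib.pair p y e) (SpecFib.pair p₀ y (SpecFib.mk p₀ z)) < ε
    have h3 : dist (SpecFib.pair p y e) (p.form z y) < ε / 2 := by
      rw [← SpecFib.pair_mk, dist_eq_norm, ← map_sub, SpecFib.norm_pair]
      calc _ ≤ ‖(show SpecFib p from e) - SpecFib.mk p z‖ * (‖y‖ + 1) := by
            gcongr
            exact (𝒞.norm_app_le _ _).trans (le_add_of_nonneg_right zero_le_one)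
        _ < ε / (2 * (‖y‖ + 1)) * (‖y‖ + 1) := by
            gcongr
        _ = ε / 2 := by field_simp
    rw [SpecFib.pair_mk]
    exact (dist_triangle _ _ _).trans_lt (by linarith [show dist (p.form z y) _ < ε / 2 from h1])

/-- Continuity into the total space is thereby reduced to complex functions that do not depend on
the phase of a representative. -/
theorem isInducing_total : IsInducing fun e : 𝒞.spectrum.Total A B =>
    (e.proj, fun y : 𝒞.Hom A B => totalPair y e) := by
  refine ⟨le_antisymm ?_ ?_⟩
  · exact continuous_iff_le_induced.1 (continuous_proj.prodMk (continuous_pi continuous_totalPair))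
  · refine le_generateFrom ?_
    rintro _ ⟨x, ε, O, hε, hO, rfl⟩
    have hV : IsOpen {z : 𝒞.SpecX A B × (𝒞.Hom A B → ℂ) | z.1 ∈ O ∧
        ∃ y, ‖z.2 y - z.1.form x y‖ < ε * √‖z.1.form y y‖} := by
      simp only [Set.ofPred_and, Set.ofPred_exists]
      refine (hO.preimage continuous_fst).inter (isOpen_iUnion fun y => isOpen_lt ?_ ?_)
      · exact (((continuous_apply y).comp continuous_snd).sub
          ((SpecX.continuous_form x y).comp continuous_fst)).norm
      · exact continuous_const.mul
          ((SpecX.continuous_form y y).comp continuous_fst).norm.sqrt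
    refine ⟨_, hV, ?_⟩
    ext e
    refine and_congr Iff.rfl ((exists_congr fun y => ?_).trans
      (SpecFib.norm_lt_iff e.proj _ ε).symm)
    rw [map_sub, SpecFib.pair_mk]
    rfl

theorem continuous_total_iff {Y : Type*} {_ : TopologicalSpace Y} {f : Y → 𝒞.spectrum.Total A B} :
    Continuous f ↔ Continuous (fun t => (f t).proj) ∧
      ∀ y, Continuous fun t => totalPair y (f t) := by
  rw [isInducing_total.continuous_iff]
  exact continuous_prodMk.trans (and_congr Iff.rfl continuous_pi_iff)

/-- The operations are known only through quotient formulas valid near t₀, where a chosen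
denominator does not vanish. -/
theorem continuous_total_of {Y : Type*} {_ : TopologicalSpace Y}
    {f : Y → 𝒞.spectrum.Total A B} (hp : Continuous fun t => (f t).proj)
    (h : ∀ y t₀, ∃ g : Y → ℂ, ContinuousAt g t₀ ∧ ∀ᶠ t in 𝓝 t₀, g t = totalPair y (f t)) :
    Continuous f :=
  continuous_total_iff.2 ⟨hp, fun y => continuous_iff_continuousAt.2 fun t₀ =>
    let ⟨_, hg, hgt⟩ := h y t₀
    hg.congr hgt⟩

theorem continuous_gelfandSection (x : 𝒞.Hom A B) :
    Continuous fun p : 𝒞.SpecX A B => 𝒞.spectrum.pt (gelfandSection x p) := by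
  refine continuous_total_iff.2 ⟨continuous_id, fun y => ?_⟩
  exact (SpecX.continuous_form x y).congr fun p => (SpecFib.pair_mk p x y).symm

theorem continuous_total_norm :
    Continuous fun e : 𝒞.spectrum.Total A B => ‖(show SpecFib e.proj from e.snd)‖ := by
  refine continuous_iff_continuousAt.2 fun e₀ => ?_
  obtain ⟨y, hy⟩ := e₀.proj.exists_form_ne
  have hc : Continuous fun e : 𝒞.spectrum.Total A B => e.proj.form y y :=
    (SpecX.continuous_form y y).comp continuous_proj
  have h1 : ContinuousAt (fun e : 𝒞.spectrum.Total A B =>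
      ‖totalPair y e‖ / √‖e.proj.form y y‖) e₀ :=
    (continuous_totalPair y).norm.continuousAt.div hc.norm.sqrt.continuousAt
      (Real.sqrt_ne_zero'.2 (norm_pos_iff.2 hy))
  refine h1.congr ?_
  filter_upwards [hc.continuousAt.eventually_ne hy] with e he
  exact (SpecFib.norm_eq_div e.proj y he _).symm

end Duality

/-! ### The spectral bundle is a spaceoid -/

section Bundle

variable {𝒞 : CommCStarCat.{u}} {A B C D : 𝒞.Obj}

theorem SpecFib.mul_mk {p : 𝒞.SpecX A B} {q : 𝒞.SpecX B C} (h : p.src = q.tgt)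
    (x : 𝒞.Hom A B) (y : 𝒞.Hom B C) :
    SpecFib.mul h (SpecFib.mk p x) (SpecFib.mk q y) = SpecFib.mk _ (𝒞.comp x y) := rfl

theorem SpecFib.star_mk (p : 𝒞.SpecX A B) (x : 𝒞.Hom A B) :
    SpecFib.star (SpecFib.mk p x) = SpecFib.mk _ (𝒞.star x) := rfl

theorem pt_mk_congr {p q : 𝒞.SpecX A B} (h : p = q) {x y : 𝒞.Hom A B} (hxy : x = y) :
    𝒞.spectrum.pt (SpecFib.mk p x) = 𝒞.spectrum.pt (SpecFib.mk q y) := by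
  subst h hxy
  rfl

theorem mk_eq_of_pt_eq {p q : 𝒞.SpecX A B} {x y : 𝒞.Hom A B}
    (h : 𝒞.spectrum.pt (SpecFib.mk p x) = 𝒞.spectrum.pt (SpecFib.mk q y)) :
    SpecFib.mk p x = SpecFib.mk p y := by
  obtain rfl : p = q := congrArg Bundle.TotalSpace.proj h
  exact eq_of_heq (Bundle.TotalSpace.mk.inj h).2

theorem continuous_pt_add {Y : Type*} {_ : TopologicalSpace Y} {p : Y → 𝒞.SpecX A B}
    {e f : ∀ t, SpecFib (p t)}
    (h : Continuous fun t => (𝒞.spectrum.pt (e t), 𝒞.spectrum.pt (f t))) :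
    Continuous fun t => 𝒞.spectrum.pt (e t + f t) := by
  have hp := continuous_proj.comp h.fst
  refine continuous_total_iff.2 ⟨hp, fun y => ?_⟩
  exact (((continuous_totalPair y).comp h.fst).add ((continuous_totalPair y).comp h.snd)).congr
    fun t => (map_add (SpecFib.pair (p t) y) (e t) (f t)).symm

/-- One pairing with ω(y) ≠ 0 scales the fiber norm by |ω(y)|, so a single coordinate already
induces the norm topology. -/
theorem isInducing_pt (p : 𝒞.SpecX A B) :
    IsInducing fun e : SpecFib p => 𝒞.spectrum.pt e := by
  refine isInducing_total.of_comp_iff.1 ?_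
  have hb : ∀ y (e : SpecFib p), ‖SpecFib.pair p y e‖ ≤ ‖y‖ * ‖e‖ := fun y e => by
    rw [SpecFib.norm_pair, mul_comm]
    gcongr
    exact 𝒞.norm_app_le _ _
  have hc : ∀ y, Continuous (SpecFib.pair p y) := fun y =>
    ((SpecFib.pair p y).mkContinuous ‖y‖ (hb y)).continuous
  obtain ⟨y, hy⟩ := p.rep_ne
  have hy' : 0 < ‖p.rep.app A B y‖ := norm_pos_iff.2 hy
  refine IsInducing.of_comp
    (g := fun z : 𝒞.SpecX A B × (𝒞.Hom A B → ℂ) => z.2 y)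
    (continuous_const.prodMk (continuous_pi hc)) ((continuous_apply y).comp continuous_snd) ?_
  have h1 : AntilipschitzWith ‖p.rep.app A B y‖₊⁻¹ (SpecFib.pair p y) :=
    AddMonoidHomClass.antilipschitz_of_bound (SpecFib.pair p y) fun e => by
      rw [SpecFib.norm_pair, NNReal.coe_inv, coe_nnnorm, mul_comm ‖e‖,
        inv_mul_cancel_left₀ hy'.ne']
  exact (h1.isUniformInducing
    ((SpecFib.pair p y).mkContinuous ‖y‖ (hb y)).uniformContinuous).isInducing

theorem exists_tube_subset (p : 𝒞.SpecX A B) (U : Set (𝒞.spectrum.Total A B))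
    (hU : U ∈ 𝓝 (𝒞.spectrum.pt (0 : SpecFib p))) :
    ∃ ε > 0, ∃ O : Set (𝒞.SpecX A B), IsOpen O ∧ p ∈ O ∧
      ∀ e : 𝒞.spectrum.Total A B, e.proj ∈ O → ‖(show SpecFib e.proj from e.snd)‖ < ε → e ∈ U := by
  let N : 𝒞.spectrum.Total A B → ℝ := fun e => ‖(show SpecFib e.proj from e.snd)‖
  -- All pairings are bounded by ‖e‖ ‖y‖, so the base point and the norm alone control the
  -- neighbourhoods of a zero vector.
  have hF : Filter.comap (fun e : 𝒞.spectrum.Total A B => e.proj) (𝓝 p) ⊓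
      Filter.comap N (𝓝 0) ≤ 𝓝 (𝒞.spectrum.pt (0 : SpecFib p)) := by
    rw [isInducing_total.nhds_eq_comap, ← Filter.tendsto_iff_comap]
    refine Filter.Tendsto.prodMk_nhds (Filter.tendsto_comap.mono_left inf_le_left)
      (tendsto_pi_nhds.2 fun y => ?_)
    rw [totalPair_pt, map_zero]
    have hN : Filter.Tendsto N (Filter.comap (fun e : 𝒞.spectrum.Total A B => e.proj) (𝓝 p) ⊓
      Filter.comap N (𝓝 0)) (𝓝 0) := Filter.tendsto_comap.mono_left inf_le_right
    refine squeeze_zero_norm (a := fun e => N e * ‖y‖) (fun e => ?_)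
      (by simpa using hN.mul_const ‖y‖)
    change ‖SpecFib.pair e.proj y _‖ ≤ _
    rw [SpecFib.norm_pair]
    exact mul_le_mul_of_nonneg_left (𝒞.norm_app_le _ _) (norm_nonneg _)
  obtain ⟨⟨O, ε⟩, ⟨⟨hp, hO⟩, hε⟩, hs⟩ := ((((nhds_basis_opens p).comap
    (fun e : 𝒞.spectrum.Total A B => e.proj)).inf (Metric.nhds_basis_ball.comap N)).mem_iff).1
      (hF hU)
  refine ⟨ε, hε, O, hO, hp, fun e he hlt => hs ⟨he, ?_⟩⟩
  change N e ∈ Metric.ball 0 ε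
  rw [mem_ball_zero_iff, Real.norm_of_nonneg (norm_nonneg _)]
  exact hlt

variable (𝒞) in
theorem spectrum_isBanachLineBundle : 𝒞.spectrum.IsBanachLineBundle where
  complete p := by
    have : FiniteDimensional ℂ (SpecFib p) :=
      FiniteDimensional.of_finrank_pos (by rw [show Module.finrank ℂ (SpecFib p) = 1 from p.2];
                                           exact one_pos)
    exact FiniteDimensional.complete ℂ (SpecFib p)
  rank_one p := p.2
  continuous_proj A B := continuous_proj
  isOpenMap_proj A B := by
    -- The Gel'fand transform through e is a continuous right inverse of the projection, so
    -- neighbourhoods of e project onto neighbourhoods of p.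
    refine isOpenMap_iff_nhds_le.2 ?_
    rintro ⟨p, e⟩
    obtain ⟨x, rfl⟩ := SpecFib.mk_surjective p e
    refine le_trans ?_ (Filter.map_mono ((continuous_gelfandSection x).tendsto p))
    rw [Filter.map_map]
    exact Filter.map_id.ge
  continuous_add A B := continuous_pt_add continuous_induced_dom
  continuous_smul A B := by
    have hp : Continuous fun z : ℂ × 𝒞.spectrum.Total A B => z.2.proj :=
      continuous_proj.comp continuous_snd
    refine continuous_total_iff.2 ⟨hp, fun y => ?_⟩
    exact (continuous_fst.mul ((continuous_totalPair y).comp continuous_snd)).congr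
      fun z => (map_smul (SpecFib.pair z.2.proj y) z.1 z.2.snd).symm
  continuous_zero A B := by
    refine (continuous_gelfandSection (0 : 𝒞.Hom A B)).congr fun p => ?_
    rw [gelfandSection, map_zero]
  continuous_norm A B := continuous_total_norm
  isInducing_fib p := isInducing_pt p
  tubular p U hU := exists_tube_subset p U hU
  saturated := by
    rintro A B ⟨p, e⟩
    obtain ⟨x, rfl⟩ := SpecFib.mk_surjective p e
    exact ⟨gelfandSection x, continuous_gelfandSection x, rfl⟩

theorem SpecX.form_of_src_eq_tgt {p : 𝒞.SpecX A B} {q : 𝒞.SpecX B C} (h : p.src = q.tgt)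
    (z w : 𝒞.Hom B C) :
    q.form z w = p.rep.app B C z * (starRingEnd ℂ) (p.rep.app B C w) :=
  (form_eq_of_charSetoid (charSetoid_of_left C (rep_of_src_eq_tgt h)) z w).symm

/-- Coordinates of a product in terms of those of its factors: each factor is measured against a
reference morphism a or b, and the phases of `p.rep` and `q.rep` cancel. -/
theorem pair_mul {p : 𝒞.SpecX A B} {q : 𝒞.SpecX B C} (h : p.src = q.tgt) (e : SpecFib p)
    (f : SpecFib q) {a : 𝒞.Hom A B} {b : 𝒞.Hom B C} (ha : p.form a a ≠ 0) (hb : q.form b b ≠ 0)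
    (y : 𝒞.Hom A C) :
    SpecFib.pair p a e * SpecFib.pair q b f *
        p.evL (𝒞.comp (𝒞.comp a b) (𝒞.star y)) / (p.form a a * q.form b b) =
      SpecFib.pair (p.comp q h) y (SpecFib.mul h e f) := by
  obtain ⟨x, rfl⟩ := SpecFib.mk_surjective p e
  obtain ⟨z, rfl⟩ := SpecFib.mk_surjective q f
  rw [div_eq_iff (mul_ne_zero ha hb), SpecFib.mul_mk, SpecFib.pair_mk, SpecFib.pair_mk,
    SpecFib.pair_mk, SpecX.form_of_src_eq_tgt h, SpecX.form_of_src_eq_tgt h, SpecX.comp,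
    SpecX.form_mk, SpecX.form, SpecX.form, SpecX.evL, app_comp_star, p.rep.map_comp,
    p.rep.map_comp]
  ring

theorem continuous_mul (A B C : 𝒞.Obj) : Continuous
    fun z : {z : 𝒞.spectrum.Total A B × 𝒞.spectrum.Total B C //
      SpecX.src z.1.proj = SpecX.tgt z.2.proj} =>
      𝒞.spectrum.pt (SpecFib.mul z.2 z.1.1.snd z.1.2.snd) := by
  have h1 : Continuous fun z : {z : 𝒞.spectrum.Total A B × 𝒞.spectrum.Total B C //
      SpecX.src z.1.proj = SpecX.tgt z.2.proj} => z.1.1 :=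
    continuous_fst.comp continuous_subtype_val
  have h2 : Continuous fun z : {z : 𝒞.spectrum.Total A B × 𝒞.spectrum.Total B C //
      SpecX.src z.1.proj = SpecX.tgt z.2.proj} => z.1.2 :=
    continuous_snd.comp continuous_subtype_val
  have hp := continuous_proj.comp h1
  have hq := continuous_proj.comp h2
  refine continuous_total_of ?_ fun y z₀ => ?_
  · exact (𝒞.spectrum_isBaseSpaceoid.continuous_comp A B C).comp
      (Continuous.subtype_mk (hp.prodMk hq) fun z => z.2)
  · obtain ⟨a, ha⟩ := SpecX.exists_form_ne z₀.1.1.proj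
    obtain ⟨b, hb⟩ := SpecX.exists_form_ne z₀.1.2.proj
    have ha' := (SpecX.continuous_form a a).comp hp
    have hb' := (SpecX.continuous_form b b).comp hq
    refine ⟨fun z => totalPair a z.1.1 * totalPair b z.1.2 *
      SpecX.evL z.1.1.proj (𝒞.comp (𝒞.comp a b) (𝒞.star y)) /
        (SpecX.form z.1.1.proj a a * SpecX.form z.1.2.proj b b), ?_, ?_⟩
    · exact ContinuousAt.div ((((continuous_totalPair a).comp h1).mul
        ((continuous_totalPair b).comp h2)).mul
          ((SpecX.continuous_evL _).comp hp)).continuousAt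
        (ha'.mul hb').continuousAt (mul_ne_zero ha hb)
    · filter_upwards [ha'.continuousAt.eventually_ne ha, hb'.continuousAt.eventually_ne hb]
        with z hza hzb
      exact pair_mul z.2 _ _ hza hzb y

theorem pair_star (p : 𝒞.SpecX A B) (e : SpecFib p) (y : 𝒞.Hom B A) :
    SpecFib.pair p.inv y (SpecFib.star e) =
      (starRingEnd ℂ) (SpecFib.pair p (𝒞.star y) e) := by
  obtain ⟨x, rfl⟩ := SpecFib.mk_surjective p e
  rw [SpecFib.star_mk, SpecFib.pair_mk, SpecFib.pair_mk, SpecX.inv, SpecX.form_mk, SpecX.form,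
    p.rep.map_star, p.rep.map_star, map_mul, RCLike.conj_conj]

theorem norm_mk_mk (ω : 𝒞.Character) (h : ∃ x, ω.app A B x ≠ 0) (x : 𝒞.Hom A B) :
    ‖SpecFib.mk (SpecX.mk ω h) x‖ = ‖ω.app A B x‖ := by
  obtain ⟨u, hu⟩ := SpecX.rep_mk ω h
  rw [SpecFib.norm_mk, hu, norm_mul, Circle.norm_coe, one_mul]

/-- Fiber norms are absolute values of character values, so submultiplicativity is an equality,
which also yields the C*-identity. -/
theorem norm_specFib_mul {p : 𝒞.SpecX A B} {q : 𝒞.SpecX B C} (h : p.src = q.tgt)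
    (e : SpecFib p) (f : SpecFib q) : ‖SpecFib.mul h e f‖ = ‖e‖ * ‖f‖ := by
  obtain ⟨x, rfl⟩ := SpecFib.mk_surjective p e
  obtain ⟨y, rfl⟩ := SpecFib.mk_surjective q f
  obtain ⟨u, hu⟩ : 𝒞.charSetoid B C p.rep q.rep :=
    charSetoid_of_left C (SpecX.rep_of_src_eq_tgt h)
  rw [SpecFib.mul_mk, SpecX.comp, norm_mk_mk, SpecFib.norm_mk, SpecFib.norm_mk, hu,
    p.rep.map_comp, norm_mul, norm_mul, Circle.norm_coe, one_mul]

theorem norm_specFib_star {p : 𝒞.SpecX A B} (e : SpecFib p) : ‖SpecFib.star e‖ = ‖e‖ := by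
  obtain ⟨x, rfl⟩ := SpecFib.mk_surjective p e
  rw [SpecFib.star_mk, SpecX.inv, norm_mk_mk, SpecFib.norm_mk, p.rep.map_star, RCLike.norm_conj]

variable (𝒞) in
theorem spectrum_isFellBundle : 𝒞.spectrum.IsFellBundle where
  add_mul {A B C p q} h e e' f := by
    obtain ⟨x, rfl⟩ := SpecFib.mk_surjective p e
    obtain ⟨x', rfl⟩ := SpecFib.mk_surjective p e'
    obtain ⟨y, rfl⟩ := SpecFib.mk_surjective q f
    exact congrArg (SpecFib.mk _) (𝒞.isComm.add_comp x x' y)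
  mul_add {A B C p q} h e f f' := by
    obtain ⟨x, rfl⟩ := SpecFib.mk_surjective p e
    obtain ⟨y, rfl⟩ := SpecFib.mk_surjective q f
    obtain ⟨y', rfl⟩ := SpecFib.mk_surjective q f'
    exact congrArg (SpecFib.mk _) (𝒞.isComm.comp_add x y y')
  smul_mul {A B C p q} h a e f := by
    obtain ⟨x, rfl⟩ := SpecFib.mk_surjective p e
    obtain ⟨y, rfl⟩ := SpecFib.mk_surjective q f
    exact congrArg (SpecFib.mk _) (𝒞.isComm.smul_comp a x y)
  mul_smul {A B C p q} h a e f := by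
    obtain ⟨x, rfl⟩ := SpecFib.mk_surjective p e
    obtain ⟨y, rfl⟩ := SpecFib.mk_surjective q f
    exact congrArg (SpecFib.mk _) (𝒞.isComm.comp_smul a x y)
  mul_assoc {A B C D p q r} e f g h h' h₁ h₁' := by
    obtain ⟨x, rfl⟩ := SpecFib.mk_surjective p e
    obtain ⟨y, rfl⟩ := SpecFib.mk_surjective q f
    obtain ⟨z, rfl⟩ := SpecFib.mk_surjective r g
    exact pt_mk_congr (𝒞.spectrum_isBaseSpaceoid.comp_assoc p q r h h' h₁ h₁')
      (𝒞.isComm.comp_assoc x y z)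
  one_mul {A B p} e h := by
    obtain ⟨x, rfl⟩ := SpecFib.mk_surjective p e
    exact pt_mk_congr (𝒞.spectrum_isBaseSpaceoid.tgt_id_comp p h) (𝒞.isComm.one_comp x)
  mul_one {A B p} e h := by
    obtain ⟨x, rfl⟩ := SpecFib.mk_surjective p e
    exact pt_mk_congr (𝒞.spectrum_isBaseSpaceoid.comp_src_id p h) (𝒞.isComm.comp_one x)
  star_star {A B p} e := by
    obtain ⟨x, rfl⟩ := SpecFib.mk_surjective p e
    refine pt_mk_congr (SpecX.eq_iff_left.2 ?_) (𝒞.isComm.star_star x)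
    rw [SpecX.rep_inv_left, SpecX.rep_inv_right]
  star_one {A} p := pt_mk_congr (SpecX.eq_iff_left.2 (SpecX.rep_inv_left p)) (𝒞.isComm.star_one A)
  star_mul {A B C p q} e f h h' := by
    obtain ⟨x, rfl⟩ := SpecFib.mk_surjective p e
    obtain ⟨y, rfl⟩ := SpecFib.mk_surjective q f
    refine pt_mk_congr (SpecX.eq_iff_left.2 ?_) (𝒞.isComm.star_comp x y)
    rw [SpecX.rep_inv_left, SpecX.rep_comp_right, SpecX.rep_comp_left, SpecX.rep_inv_left]
  star_add {A B p} e f := by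
    obtain ⟨x, rfl⟩ := SpecFib.mk_surjective p e
    obtain ⟨y, rfl⟩ := SpecFib.mk_surjective p f
    exact congrArg (SpecFib.mk _) (𝒞.isComm.star_add x y)
  star_smul {A B p} a e := by
    obtain ⟨x, rfl⟩ := SpecFib.mk_surjective p e
    exact congrArg (SpecFib.mk _) (𝒞.isComm.star_smul a x)
  norm_mul_le h e f := (norm_specFib_mul h e f).le
  norm_star_mul_self {A B p} e h := by
    rw [sq]
    exact (norm_specFib_mul h _ e).trans (congrArg (· * _) (norm_specFib_star e))
  star_mul_self_pos {A B p} e h h' := by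
    obtain ⟨x, rfl⟩ := SpecFib.mk_surjective p e
    obtain ⟨y, hy⟩ := 𝒞.isComm.star_comp_self_pos x
    refine ⟨SpecFib.mk _ y, pt_mk_congr (SpecX.eq_iff_left.2 ?_) hy⟩
    rw [SpecX.rep_comp_left, SpecX.rep_comp_left, SpecX.rep_inv_left, SpecX.rep_inv_left,
      SpecX.rep_src]
  continuous_mul A B C := continuous_mul A B C
  continuous_star A B := by
    refine continuous_total_iff.2
      ⟨(𝒞.spectrum_isBaseSpaceoid.continuous_inv A B).comp continuous_proj, fun y => ?_⟩
    exact (Complex.continuous_conj.comp (continuous_totalPair (𝒞.star y))).congr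
      fun e => (pair_star e.proj e.snd y).symm
  continuous_one A := continuous_gelfandSection (𝒞.one A)

variable (𝒞) in
theorem spectrum_isSpaceoid : 𝒞.spectrum.IsSpaceoid :=
  ⟨𝒞.spectrum_isBaseSpaceoid, 𝒞.spectrum_isBanachLineBundle, 𝒞.spectrum_isFellBundle⟩

end Bundle

/-! ### Sections of the spectral bundle -/

section Sections

variable {𝒞 : CommCStarCat.{u}} {A B C D : 𝒞.Obj}

theorem isC0_gelfandSection (x : 𝒞.Hom A B) :
    SpaceoidData.Section.IsC0 (𝓔 := 𝒞.spectrum) (gelfandSection x) where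
  continuous := continuous_gelfandSection x
  vanishing ε hε := by
    -- The points with ε ≤ |ω(x)| are those over this closed set, which consists of targets because
    -- ε > 0.
    have hcl : IsClosed {P : 𝒞.SpecX A A | ε ^ 2 ≤ ‖P.evL (𝒞.comp x (𝒞.star x))‖} :=
      isClosed_le continuous_const (SpecX.continuous_evL_diag _).norm
    refine ⟨_, SpecX.isCompact_preimage_tgt (B := B) hcl fun P hP => ?_, fun p hp => ?_⟩
    · exact SpecX.mem_range_tgt.2 ⟨x, norm_pos_iff.1 (lt_of_lt_of_le (by positivity) hP)⟩
    · have h1 : ‖p.tgt.evL (𝒞.comp x (𝒞.star x))‖ < ε ^ 2 := not_le.1 hp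
      rw [SpecX.evL_tgt, ← SpecX.form_eq_evL, SpecX.norm_form_self, ← SpecFib.norm_mk] at h1
      exact lt_of_pow_lt_pow_left₀ 2 hε.le h1

theorem norm_le_of_gelfandSection_le {x : 𝒞.Hom A B} {M : ℝ} (hM : 0 ≤ M)
    (h : ∀ p : 𝒞.SpecX A B, ‖gelfandSection x p‖ ≤ M) : ‖x‖ ≤ M :=
  SpecX.norm_le_of_rep_le hM fun p => (SpecFib.norm_mk p x).symm.trans_le (h p)

theorem norm_gelfandSection_le (x : 𝒞.Hom A B) (p : 𝒞.SpecX A B) : ‖gelfandSection x p‖ ≤ ‖x‖ :=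
  (SpecFib.norm_mk p x).trans_le (𝒞.norm_app_le _ _)

theorem mk_comp_left (p : 𝒞.SpecX A B) (a : 𝒞.Hom A A) (x : 𝒞.Hom A B) :
    SpecFib.mk p (𝒞.comp a x) = p.tgt.evL a • SpecFib.mk p x := by
  rw [← map_smul, SpecFib.mk_eq_mk_iff, SpecX.evL_eq_of_tgt, map_smul, smul_eq_mul]

theorem isOpen_norm_sub_lt {σ : ∀ p : 𝒞.SpecX A B, SpecFib p}
    (hσ : Continuous fun p => 𝒞.spectrum.pt (σ p)) (x : 𝒞.Hom A B) (ε : ℝ) :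
    IsOpen {p | ‖σ p - SpecFib.mk p x‖ < ε} := by
  have h1 := continuous_total_norm.comp
    (continuous_pt_add (hσ.prodMk (continuous_gelfandSection (-x))))
  convert isOpen_lt h1 (continuous_const (y := ε)) using 2
  ext p
  change ‖_‖ < ε ↔ ‖σ p + SpecFib.mk p (-x)‖ < ε
  rw [map_neg, sub_eq_add_neg]

/-- Continuous sections vanishing at infinity are uniformly approximated by Gel'fand
transforms. -/
theorem exists_norm_sub_mk_le {σ : 𝒞.spectrum.Section A B} (hσ : σ.IsC0) {ε : ℝ} (hε : 0 < ε) :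
    ∃ x : 𝒞.Hom A B, ∀ p, ‖(show SpecFib p from σ p) - SpecFib.mk p x‖ ≤ ε := by
  obtain ⟨K, hK, hKσ⟩ := hσ.vanishing (ε / 2) (half_pos hε)
  choose x hx using fun p : 𝒞.SpecX A B => SpecFib.mk_surjective p (σ p)
  let W : 𝒞.SpecX A B → Set (𝒞.SpecX A B) := fun p =>
    {q | ‖(show SpecFib q from σ q) - SpecFib.mk q (x p)‖ < ε / 2}
  have hW : ∀ p, IsOpen (W p) := fun p => isOpen_norm_sub_lt hσ.continuous (x p) (ε / 2)
  obtain ⟨t, -, ht⟩ := hK.elim_nhds_subcover W fun p _ => (hW p).mem_nhds (by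
    change ‖(show SpecFib p from σ p) - SpecFib.mk p (x p)‖ < ε / 2
    rw [hx p, sub_self, norm_zero]
    exact half_pos hε)
  -- The partition lives on the compact Hausdorff space 𝒳_{AA}, where its functions are values of
  -- elements of 𝒞_{AA}; gluing becomes left multiplication by these elements.
  obtain ⟨f, hf⟩ := PartitionOfUnity.exists_isSubordinate
    (hK.image SpecX.continuous_tgt).isClosed (fun i : t => SpecX.tgt '' W i)
    (fun i => SpecX.isOpenEmbedding_tgt.isOpenMap _ (hW i)) (by
      rintro _ ⟨p, hp, rfl⟩
      obtain ⟨i, hi, hpi⟩ := Set.mem_iUnion₂.1 (ht hp)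
      exact Set.mem_iUnion.2 ⟨⟨i, hi⟩, p, hpi, rfl⟩)
  choose a ha using fun i : t => SpecX.exists_evL_eq
    (⟨fun P => ((f i P : ℝ) : ℂ), Complex.continuous_ofReal.comp (f i).continuous⟩ :
      C(𝒞.SpecX A A, ℂ))
  refine ⟨∑ i, 𝒞.comp (a i) (x i), fun q => ?_⟩
  set e : SpecFib q := σ q with he
  have hsum : ∑ i, f i q.tgt ≤ 1 := by
    rw [← finsum_eq_sum_of_fintype]
    exact f.sum_le_one _
  -- The first term vanishes on K, where the f i sum to 1, and is below ε / 2 off K. The second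
  -- combines errors below ε / 2 with weights of sum at most 1.
  have hdec : e - SpecFib.mk q (∑ i, 𝒞.comp (a i) (x i)) =
      (1 - ∑ i, f i q.tgt) • e + ∑ i, f i q.tgt • (e - SpecFib.mk q (x i)) := by
    have hs : ∀ i, SpecFib.mk q (𝒞.comp (a i) (x i)) = f i q.tgt • SpecFib.mk q (x i) := fun i => by
      rw [mk_comp_left, ha]
      exact Complex.coe_smul _ _
    rw [map_sum, Finset.sum_congr rfl fun i _ => hs i]
    simp only [smul_sub, Finset.sum_sub_distrib, ← Finset.sum_smul, sub_smul, one_smul]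
    abel
  have h1 : ‖(1 - ∑ i, f i q.tgt) • e‖ ≤ ε / 2 := by
    by_cases hq : q ∈ K
    · have := f.sum_eq_one (Set.mem_image_of_mem SpecX.tgt hq)
      rw [finsum_eq_sum_of_fintype] at this
      rw [this, sub_self, zero_smul, norm_zero]
      exact (half_pos hε).le
    · rw [norm_smul, Real.norm_of_nonneg (sub_nonneg.2 hsum)]
      refine (mul_le_of_le_one_left (norm_nonneg _) ?_).trans (hKσ q hq).le
      exact sub_le_self _ (Finset.sum_nonneg fun i _ => f.nonneg i _)
  have h2 : ‖∑ i, f i q.tgt • (e - SpecFib.mk q (x i))‖ ≤ ∑ i, f i q.tgt * (ε / 2) := by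
    refine norm_sum_le_of_le _ fun i _ => ?_
    rw [norm_smul, Real.norm_of_nonneg (f.nonneg i _)]
    by_cases h0 : f i q.tgt = 0
    · rw [h0, zero_mul, zero_mul]
    -- Injectivity of the target map brings the support condition back from 𝒳_{AA} to W i.
    · obtain ⟨q', hq', hqq⟩ := hf i (subset_tsupport _ h0)
      obtain rfl := SpecX.isEmbedding_tgt.injective hqq
      exact mul_le_mul_of_nonneg_left (le_of_lt hq') (f.nonneg i _)
  rw [← Finset.sum_mul] at h2
  rw [hdec]
  refine (norm_add_le _ _).trans ((add_le_add h1 h2).trans ?_)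
  have := mul_le_mul_of_nonneg_right hsum (half_pos hε).le
  linarith

/-- Every continuous section vanishing at infinity is a Gel'fand transform. -/
theorem exists_gelfandSection_eq {σ : 𝒞.spectrum.Section A B} (hσ : σ.IsC0) :
    ∃ x : 𝒞.Hom A B, gelfandSection x = σ := by
  have := 𝒞.isComm.complete A B
  choose x hx using fun n : ℕ =>
    exists_norm_sub_mk_le hσ (ε := 1 / ((n : ℝ) + 1)) Nat.one_div_pos_of_nat
  have hlim : Filter.Tendsto (fun n : ℕ => 1 / ((n : ℝ) + 1)) Filter.atTop (𝓝 0) :=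
    tendsto_one_div_add_atTop_nhds_zero_nat
  have hc : CauchySeq x := by
    -- Uniform closeness of the transforms is closeness in norm, by the Gel'fand isometry.
    refine cauchySeq_of_le_tendsto_0 (fun n : ℕ => 1 / ((n : ℝ) + 1) + 1 / ((n : ℝ) + 1))
      (fun n m N hn hm => ?_) (by simpa using hlim.add hlim)
    rw [dist_eq_norm]
    refine norm_le_of_gelfandSection_le (by positivity) fun p => ?_
    have h1 := (hx n p).trans (Nat.one_div_le_one_div hn)
    have h2 := (hx m p).trans (Nat.one_div_le_one_div hm)
    rw [gelfandSection, map_sub]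
    rw [norm_sub_rev] at h1
    refine le_trans ?_ (add_le_add h1 h2)
    refine (congrArg norm ?_).trans_le (norm_add_le _ _)
    abel
  obtain ⟨y, hy⟩ := cauchySeq_tendsto_of_complete hc
  refine ⟨y, funext fun p => ?_⟩
  have h1 : Filter.Tendsto (fun n => ‖SpecFib.mk p (x n) - SpecFib.mk p y‖)
      Filter.atTop (𝓝 0) := by
    refine squeeze_zero (fun n => norm_nonneg _) (fun n => ?_) (tendsto_iff_norm_sub_tendsto_zero.1 hy)
    rw [← map_sub]
    exact norm_gelfandSection_le _ _
  have h2 : Filter.Tendsto (fun n => SpecFib.mk p (x n)) Filter.atTop (𝓝 (SpecFib.mk p y)) :=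
    tendsto_iff_norm_sub_tendsto_zero.2 h1
  have h3 : Filter.Tendsto (fun n => SpecFib.mk p (x n)) Filter.atTop
      (𝓝 (show SpecFib p from σ p)) := by
    refine tendsto_iff_norm_sub_tendsto_zero.2
      (squeeze_zero (fun n => norm_nonneg _) (fun n => ?_) hlim)
    rw [norm_sub_rev]
    exact hx n p
  exact tendsto_nhds_unique h2 h3

theorem gelfandSection_comp (x : 𝒞.Hom A B) (y : 𝒞.Hom B C) :
    SpaceoidData.Section.comp (𝓔 := 𝒞.spectrum) (gelfandSection x) (gelfandSection y) =
      gelfandSection (𝒞.comp x y) := by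
  funext r
  unfold SpaceoidData.Section.comp
  split_ifs with h
  · have key : ∀ (p : 𝒞.SpecX A B) (q : 𝒞.SpecX B C) (hpq : p.src = q.tgt) (r : 𝒞.SpecX A C)
        (hr : p.comp q hpq = r),
        (hr ▸ SpecFib.mul hpq (gelfandSection x p) (gelfandSection y q) : SpecFib r) =
          gelfandSection (𝒞.comp x y) r := by
      rintro p q hpq _ rfl
      rfl
    exact key _ _ _ _ h.choose_spec
  -- If ω(x y) = ω(x) ω(y) were non-zero, ω would be non-zero on 𝒞_{AB} and on 𝒞_{BC}, and r would
  -- be the composite of these two classes.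
  · by_contra hne
    have h0 : r.rep.app A C (𝒞.comp x y) ≠ 0 := fun h0 => hne (by
      have := (SpecFib.mk_eq_mk_iff r).2 (h0.trans (map_zero _).symm)
      rw [map_zero] at this
      exact this.symm)
    rw [r.rep.map_comp] at h0
    have hx : ∃ x, r.rep.app A B x ≠ 0 := ⟨x, left_ne_zero_of_mul h0⟩
    have hy : ∃ y, r.rep.app B C y ≠ 0 := ⟨y, right_ne_zero_of_mul h0⟩
    refine h ⟨⟨(SpecX.mk r.rep hx, SpecX.mk r.rep hy), SpecX.src_eq_tgt_iff.2 ?_⟩, ?_⟩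
    · rw [SpecX.rep_mk_left, SpecX.rep_mk_right]
    · exact SpecX.eq_iff_left.2 (by rw [SpecX.rep_comp_left, SpecX.rep_mk_left])

theorem gelfandSection_star (x : 𝒞.Hom A B) :
    SpaceoidData.Section.star (𝓔 := 𝒞.spectrum) (gelfandSection x) =
      gelfandSection (𝒞.star x) := by
  funext r
  unfold SpaceoidData.Section.star
  have h : ∃ p : 𝒞.SpecX A B, p.inv = r :=
    ⟨r.inv, SpecX.eq_iff_left.2 (by rw [SpecX.rep_inv_left, SpecX.rep_inv_right])⟩
  rw [dif_pos h]
  have key : ∀ (p : 𝒞.SpecX A B) (r : 𝒞.SpecX B A) (hr : p.inv = r),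
      (hr ▸ SpecFib.star (gelfandSection x p) : SpecFib r) = gelfandSection (𝒞.star x) r := by
    rintro p _ rfl
    rfl
  exact key _ _ h.choose_spec

theorem gelfandSection_zero :
    gelfandSection (0 : 𝒞.Hom A B) = (0 : 𝒞.spectrum.Section A B) :=
  funext fun p => (SpecFib.mk p).map_zero

theorem gelfandSection_add (x y : 𝒞.Hom A B) :
    gelfandSection (x + y) = (gelfandSection x + gelfandSection y : 𝒞.spectrum.Section A B) :=
  funext fun p => (SpecFib.mk p).map_add x y

theorem gelfandSection_smul (a : ℂ) (x : 𝒞.Hom A B) :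
    gelfandSection (a • x) = (a • gelfandSection x : 𝒞.spectrum.Section A B) :=
  funext fun p => (SpecFib.mk p).map_smul a x

-- Each C₀-section is some x̂, so its closure properties are those of the operations of 𝒞.
variable (𝒞) in
theorem spectrum_sectionsClosed : 𝒞.spectrum.SectionsClosed where
  zero A B := gelfandSection_zero (𝒞 := 𝒞) ▸ isC0_gelfandSection (0 : 𝒞.Hom A B)
  add hσ hρ := by
    obtain ⟨x, rfl⟩ := exists_gelfandSection_eq hσ
    obtain ⟨y, rfl⟩ := exists_gelfandSection_eq hρ
    exact gelfandSection_add x y ▸ isC0_gelfandSection (x + y)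
  smul a _ hσ := by
    obtain ⟨x, rfl⟩ := exists_gelfandSection_eq hσ
    exact gelfandSection_smul a x ▸ isC0_gelfandSection (a • x)
  comp hσ hρ := by
    obtain ⟨x, rfl⟩ := exists_gelfandSection_eq hσ
    obtain ⟨y, rfl⟩ := exists_gelfandSection_eq hρ
    exact gelfandSection_comp x y ▸ isC0_gelfandSection (𝒞.comp x y)
  star hσ := by
    obtain ⟨x, rfl⟩ := exists_gelfandSection_eq hσ
    exact gelfandSection_star x ▸ isC0_gelfandSection (𝒞.star x)
  one A := isC0_gelfandSection (𝒞.one A)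
  bddAbove hσ := by
    obtain ⟨x, rfl⟩ := exists_gelfandSection_eq hσ
    refine ⟨‖x‖, ?_⟩
    rintro _ ⟨p, rfl⟩
    exact norm_gelfandSection_le x p

end Sections

/-! ### The category of sections of the spectral bundle -/

section GammaSpectrum

variable {𝒞 : CommCStarCat.{u}} (hΓ : 𝒞.spectrum.SectionsClosed) {A B C D : 𝒞.Obj}

instance (A B : 𝒞.Obj) : NormedAddCommGroup ((𝒞.spectrum.Gamma hΓ).Hom A B) :=
  (𝒞.spectrum.Gamma hΓ).normedAddCommGroup A B

instance (A B : 𝒞.Obj) : NormedSpace ℂ ((𝒞.spectrum.Gamma hΓ).Hom A B) :=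
  (𝒞.spectrum.Gamma hΓ).normedSpace A B

/-- The Gel'fand transform as an element of `Γ(Σ(𝒞))_{AB}`. -/
def transform (x : 𝒞.Hom A B) : (𝒞.spectrum.Gamma hΓ).Hom A B :=
  ⟨gelfandSection x, isC0_gelfandSection x⟩

theorem transform_surjective : Function.Surjective (transform hΓ : 𝒞.Hom A B → _) := fun σ =>
  (exists_gelfandSection_eq σ.2).imp fun _ h => Subtype.ext h

theorem norm_transform (x : 𝒞.Hom A B) : ‖transform hΓ x‖ = ‖x‖ := by
  -- The non-negative bound also covers empty 𝒳_{AB}, where the supremum is 0.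
  refine le_antisymm (Real.iSup_le (norm_gelfandSection_le x) (norm_nonneg x)) ?_
  exact norm_le_of_gelfandSection_le (norm_nonneg _)
    fun p => le_ciSup (hΓ.bddAbove (isC0_gelfandSection x)) p

theorem transform_add (x y : 𝒞.Hom A B) :
    transform hΓ (x + y) = transform hΓ x + transform hΓ y :=
  Subtype.ext (gelfandSection_add x y)

theorem transform_smul (a : ℂ) (x : 𝒞.Hom A B) :
    transform hΓ (a • x) = a • transform hΓ x :=
  Subtype.ext (gelfandSection_smul a x)

theorem transform_comp (x : 𝒞.Hom A B) (y : 𝒞.Hom B C) :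
    transform hΓ (𝒞.comp x y) =
      (𝒞.spectrum.Gamma hΓ).comp (transform hΓ x) (transform hΓ y) :=
  Subtype.ext (gelfandSection_comp x y).symm

theorem transform_star (x : 𝒞.Hom A B) :
    transform hΓ (𝒞.star x) = (𝒞.spectrum.Gamma hΓ).star (transform hΓ x) :=
  Subtype.ext (gelfandSection_star x).symm

theorem transform_one (A : 𝒞.Obj) :
    transform hΓ (𝒞.one A) = (𝒞.spectrum.Gamma hΓ).one A := rfl

/-- The Gel'fand transform as a linear isometric isomorphism. -/
def transformEquiv (A B : 𝒞.Obj) : 𝒞.Hom A B ≃ₗᵢ[ℂ] (𝒞.spectrum.Gamma hΓ).Hom A B :=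
  LinearIsometryEquiv.ofSurjective
    { toFun := transform hΓ
      map_add' := transform_add hΓ
      map_smul' := transform_smul hΓ
      norm_map' := norm_transform hΓ }
    (transform_surjective hΓ)

/-- The axioms are transported along the isometric bijection x ↦ x̂, which respects all operations.
-/
theorem gamma_isCommCStarCat : (𝒞.spectrum.Gamma hΓ).IsCommCStarCat where
  complete A B := by
    have := 𝒞.isComm.complete A B
    exact (transformEquiv hΓ A B).symm.toIsometryEquiv.completeSpace
  comp_assoc σ ρ τ := by
    obtain ⟨x, rfl⟩ := transform_surjective hΓ σ
    obtain ⟨y, rfl⟩ := transform_surjective hΓ ρ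
    obtain ⟨z, rfl⟩ := transform_surjective hΓ τ
    rw [← transform_comp, ← transform_comp, ← transform_comp, ← transform_comp,
      𝒞.isComm.comp_assoc]
  one_comp σ := by
    obtain ⟨x, rfl⟩ := transform_surjective hΓ σ
    rw [← transform_one, ← transform_comp, 𝒞.isComm.one_comp]
  comp_one σ := by
    obtain ⟨x, rfl⟩ := transform_surjective hΓ σ
    rw [← transform_one, ← transform_comp, 𝒞.isComm.comp_one]
  add_comp σ ρ τ := by
    obtain ⟨x, rfl⟩ := transform_surjective hΓ σ
    obtain ⟨y, rfl⟩ := transform_surjective hΓ ρ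
    obtain ⟨z, rfl⟩ := transform_surjective hΓ τ
    rw [← transform_add, ← transform_comp, ← transform_comp, ← transform_comp, ← transform_add,
      𝒞.isComm.add_comp]
  comp_add σ ρ τ := by
    obtain ⟨x, rfl⟩ := transform_surjective hΓ σ
    obtain ⟨y, rfl⟩ := transform_surjective hΓ ρ
    obtain ⟨z, rfl⟩ := transform_surjective hΓ τ
    rw [← transform_add, ← transform_comp, ← transform_comp, ← transform_comp, ← transform_add,
      𝒞.isComm.comp_add]
  smul_comp a σ ρ := by
    obtain ⟨x, rfl⟩ := transform_surjective hΓ σ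
    obtain ⟨y, rfl⟩ := transform_surjective hΓ ρ
    rw [← transform_smul, ← transform_comp, ← transform_comp, ← transform_smul,
      𝒞.isComm.smul_comp]
  comp_smul a σ ρ := by
    obtain ⟨x, rfl⟩ := transform_surjective hΓ σ
    obtain ⟨y, rfl⟩ := transform_surjective hΓ ρ
    rw [← transform_smul, ← transform_comp, ← transform_comp, ← transform_smul,
      𝒞.isComm.comp_smul]
  star_star σ := by
    obtain ⟨x, rfl⟩ := transform_surjective hΓ σ
    rw [← transform_star, ← transform_star, 𝒞.isComm.star_star]
  star_one A := by
    rw [← transform_one, ← transform_star, 𝒞.isComm.star_one]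
  star_comp σ ρ := by
    obtain ⟨x, rfl⟩ := transform_surjective hΓ σ
    obtain ⟨y, rfl⟩ := transform_surjective hΓ ρ
    rw [← transform_comp, ← transform_star, ← transform_star, ← transform_star, ← transform_comp,
      𝒞.isComm.star_comp]
  star_add σ ρ := by
    obtain ⟨x, rfl⟩ := transform_surjective hΓ σ
    obtain ⟨y, rfl⟩ := transform_surjective hΓ ρ
    rw [← transform_add, ← transform_star, ← transform_star, ← transform_star, ← transform_add,
      𝒞.isComm.star_add]
  star_smul a σ := by
    obtain ⟨x, rfl⟩ := transform_surjective hΓ σ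
    rw [← transform_smul, ← transform_star, ← transform_star, ← transform_smul,
      𝒞.isComm.star_smul]
  norm_comp_le σ ρ := by
    obtain ⟨x, rfl⟩ := transform_surjective hΓ σ
    obtain ⟨y, rfl⟩ := transform_surjective hΓ ρ
    rw [← transform_comp, norm_transform, norm_transform, norm_transform]
    exact 𝒞.isComm.norm_comp_le x y
  norm_star_comp_self σ := by
    obtain ⟨x, rfl⟩ := transform_surjective hΓ σ
    rw [← transform_star, ← transform_comp, norm_transform, norm_transform]
    exact 𝒞.isComm.norm_star_comp_self x
  star_comp_self_pos σ := by
    obtain ⟨x, rfl⟩ := transform_surjective hΓ σ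
    obtain ⟨y, hy⟩ := 𝒞.isComm.star_comp_self_pos x
    refine ⟨transform hΓ y, ?_⟩
    rw [← transform_star, ← transform_comp, ← transform_star, ← transform_comp, hy]
  comm σ ρ := by
    obtain ⟨x, rfl⟩ := transform_surjective hΓ σ
    obtain ⟨y, rfl⟩ := transform_surjective hΓ ρ
    rw [← transform_comp, ← transform_comp, 𝒞.isComm.comm]

/-- The restriction of a character of `Γ(Σ(𝒞))` along the Gel'fand transform. -/
def transformPullback (ω : (𝒞.spectrum.Gamma hΓ).Character) : 𝒞.Character where
  app A B := ω.app A B ∘ₗ (transformEquiv hΓ A B).toLinearEquiv.toLinearMap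
  map_comp x y := (congrArg (ω.app _ _) (transform_comp hΓ x y)).trans (ω.map_comp _ _)
  map_star x := (congrArg (ω.app _ _) (transform_star hΓ x)).trans (ω.map_star _)

/-- The inverse of the Gel'fand transform. -/
def inverseTransform : (𝒞.spectrum.Gamma hΓ).LinFunctor 𝒞.toCStarCatData where
  obj := id
  map {A B} := (transformEquiv hΓ A B).symm.toLinearEquiv.toLinearMap

theorem inverseTransform_transform (x : 𝒞.Hom A B) :
    (inverseTransform hΓ).map (transform hΓ x) = x :=
  (transformEquiv hΓ A B).symm_apply_apply x

theorem transform_inverseTransform (σ : (𝒞.spectrum.Gamma hΓ).Hom A B) :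
    transform hΓ ((inverseTransform hΓ).map σ) = σ :=
  (transformEquiv hΓ A B).apply_symm_apply σ

theorem inverseTransform_isMorphism : (inverseTransform hΓ).IsMorphism where
  bijective := Function.bijective_id
  map_one A := inverseTransform_transform hΓ (𝒞.one A)
  map_comp σ ρ := by
    obtain ⟨x, rfl⟩ := transform_surjective hΓ σ
    obtain ⟨y, rfl⟩ := transform_surjective hΓ ρ
    rw [← transform_comp, inverseTransform_transform, inverseTransform_transform,
      inverseTransform_transform]
    rfl
  map_star σ := by
    obtain ⟨x, rfl⟩ := transform_surjective hΓ σ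
    rw [← transform_star, inverseTransform_transform, inverseTransform_transform]
    rfl
  nondegenerate ω A B := fun ⟨y, hy⟩ =>
    ⟨transform hΓ y, fun h0 =>
      hy ((congrArg (ω.app A B) (inverseTransform_transform hΓ y)).symm.trans h0)⟩

theorem gelfand_isMorphism : (𝒞.gelfand hΓ isC0_gelfandSection).IsMorphism where
  bijective := Function.bijective_id
  map_one A := transform_one hΓ A
  map_comp x y := transform_comp hΓ x y
  map_star x := transform_star hΓ x
  nondegenerate ω A B := fun ⟨y, hy⟩ => by
    obtain ⟨x, rfl⟩ := transform_surjective hΓ y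
    exact ⟨x, hy⟩

end GammaSpectrum

/-! ### The spectral functor on morphisms -/

section Functoriality

variable {𝒞 𝒟 : CommCStarCat.{u}} (φ : 𝒞 ⟶ 𝒟) {A B C : 𝒞.Obj}

/-- Non-degeneracy of φ makes `p.rep` composed with φ a point of 𝒳_{AB}; the chosen representative
of that point may differ by a phase. -/
theorem SpecX.rep_pullback (p : 𝒟.SpecX (φ.obj A) (φ.obj B)) :
    𝒞.charSetoid A B (p.pullback φ).rep (p.rep.pullback φ) := by
  have h : ∃ x, (p.rep.pullback φ).app A B x ≠ 0 :=
    φ.isMorphism.nondegenerate p.rep A B p.rep_ne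
  have h1 : p.pullback φ = SpecX.mk (p.rep.pullback φ) h :=
    congrArg (SpecX.pullback φ) p.mk_rep'.symm
  rw [h1]
  exact rep_mk _ _

theorem SpecX.evL_pullback (p : 𝒟.SpecX (φ.obj A) (φ.obj B)) (c : 𝒞.Hom A A) :
    (p.pullback φ).evL c = p.evL (φ.map c) :=
  LinearMap.congr_fun (charSetoid_left (SpecX.rep_ne _) (p.rep_pullback φ)) c

theorem SpecX.evR_pullback (p : 𝒟.SpecX (φ.obj A) (φ.obj B)) (c : 𝒞.Hom B B) :
    (p.pullback φ).rep.app B B c = p.rep.app (φ.obj B) (φ.obj B) (φ.map c) :=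
  LinearMap.congr_fun (charSetoid_right (SpecX.rep_ne _) (p.rep_pullback φ)) c

theorem SpecX.form_pullback (p : 𝒟.SpecX (φ.obj A) (φ.obj B)) (x y : 𝒞.Hom A B) :
    (p.pullback φ).form x y = p.form (φ.map x) (φ.map y) :=
  form_eq_of_charSetoid (p.rep_pullback φ) x y

theorem SpecX.tgt_pullback (p : 𝒟.SpecX (φ.obj A) (φ.obj B)) :
    SpecX.pullback (A := A) (B := A) φ p.tgt = (p.pullback φ).tgt := by
  rw [eq_iff_left]
  ext c
  change SpecX.evL _ c = SpecX.evL _ c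
  rw [evL_pullback, evL_tgt, evL_tgt, evL_pullback]

theorem SpecX.src_pullback (p : 𝒟.SpecX (φ.obj A) (φ.obj B)) :
    SpecX.pullback (A := B) (B := B) φ p.src = (p.pullback φ).src := by
  rw [eq_iff_left]
  ext c
  rw [rep_src, evR_pullback, evR_pullback, rep_src]

theorem SpecX.continuous_pullback :
    Continuous (SpecX.pullback φ : 𝒟.SpecX (φ.obj A) (φ.obj B) → 𝒞.SpecX A B) :=
  continuous_iff_form.2 fun x y => (continuous_form _ _).congr fun p => (p.form_pullback φ x y).symm

/-- The preimage lies over a closed subset of the diagonal spectrum of 𝒟. That subset consists of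
targets: if (P ∘ φ)(x x*) ≠ 0, then φ(x) is a witness for P. -/
theorem SpecX.isCompact_preimage_pullback {K : Set (𝒞.SpecX A B)} (hK : IsCompact K) :
    IsCompact (SpecX.pullback φ ⁻¹' K : Set (𝒟.SpecX (φ.obj A) (φ.obj B))) := by
  have h1 : IsClosed (SpecX.pullback (A := A) (B := A) φ ⁻¹' (SpecX.tgt '' K)) :=
    (hK.image continuous_tgt).isClosed.preimage (continuous_pullback φ)
  convert isCompact_preimage_tgt (B := φ.obj B) h1 ?_ using 1
  · ext p
    simp only [Set.mem_preimage]
    rw [tgt_pullback, isEmbedding_tgt.injective.mem_set_image]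
  · rintro P ⟨p, -, hp⟩
    obtain ⟨x, hx⟩ := mem_range_tgt.1 ⟨p, hp⟩
    refine mem_range_tgt.2 ⟨φ.map x, ?_⟩
    rw [evL_pullback, φ.isMorphism.map_comp, φ.isMorphism.map_star] at hx
    exact hx

theorem specFibMap_mk (p : 𝒟.SpecX (φ.obj A) (φ.obj B)) (x : 𝒞.Hom A B) :
    specFibMap φ p (SpecFib.mk _ x) = SpecFib.mk p (φ.map x) := rfl

/-- The squared norm is the diagonal of the form, and forms pull back along φ without a phase. -/
theorem norm_specFibMap (p : 𝒟.SpecX (φ.obj A) (φ.obj B)) (e : SpecFib (p.pullback φ)) :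
    ‖specFibMap φ p e‖ = ‖e‖ := by
  obtain ⟨x, rfl⟩ := SpecFib.mk_surjective _ e
  rw [specFibMap_mk, SpecFib.norm_mk, SpecFib.norm_mk, ← sq_eq_sq₀ (norm_nonneg _) (norm_nonneg _),
    ← SpecX.norm_form_self, ← SpecX.norm_form_self, SpecX.form_pullback]

theorem pair_specFibMap (p : 𝒟.SpecX (φ.obj A) (φ.obj B)) (e : SpecFib (p.pullback φ))
    {a : 𝒞.Hom A B} (ha : p.form (φ.map a) (φ.map a) ≠ 0) (y : 𝒟.Hom (φ.obj A) (φ.obj B)) :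
    SpecFib.pair (p.pullback φ) a e * p.form (φ.map a) y / p.form (φ.map a) (φ.map a) =
      SpecFib.pair p y (specFibMap φ p e) := by
  obtain ⟨x, rfl⟩ := SpecFib.mk_surjective _ e
  rw [div_eq_iff ha, specFibMap_mk, SpecFib.pair_mk, SpecFib.pair_mk, SpecX.form_pullback]
  simp only [SpecX.form]
  ring

theorem continuous_specFibMap {Y : Type*} {_ : TopologicalSpace Y}
    {p : Y → 𝒟.SpecX (φ.obj A) (φ.obj B)} {e : ∀ t, SpecFib ((p t).pullback φ)}
    (h : Continuous fun t => (p t, 𝒞.spectrum.pt (e t))) :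
    Continuous fun t => 𝒟.spectrum.pt (specFibMap φ (p t) (e t)) := by
  have hp : Continuous p := h.fst
  refine continuous_total_of hp fun y t₀ => ?_
  obtain ⟨a, ha⟩ := ((p t₀).pullback φ).exists_form_ne
  rw [SpecX.form_pullback] at ha
  have ha' := (SpecX.continuous_form (φ.map a) (φ.map a)).comp hp
  refine ⟨fun t => SpecFib.pair ((p t).pullback φ) a (e t) * (p t).form (φ.map a) y /
    (p t).form (φ.map a) (φ.map a), ?_, ?_⟩
  · exact ((((continuous_totalPair a).comp h.snd).mul
      ((SpecX.continuous_form _ y).comp hp)).continuousAt).div ha'.continuousAt ha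
  · filter_upwards [ha'.continuousAt.eventually_ne ha] with t ht
    exact pair_specFibMap φ (p t) (e t) ht y

/-- Handles fibers over base points that are only propositionally equal: a representative of the
coset is all that matters. -/
theorem specFibMap_eq_of_pt_eq (p : 𝒟.SpecX (φ.obj A) (φ.obj B)) {q : 𝒞.SpecX A B}
    {x : 𝒞.Hom A B} (g : SpecFib (p.pullback φ))
    (h : 𝒞.spectrum.pt g = 𝒞.spectrum.pt (SpecFib.mk q x)) :
    specFibMap φ p g = SpecFib.mk p (φ.map x) := by
  obtain ⟨z, rfl⟩ := SpecFib.mk_surjective _ g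
  rw [mk_eq_of_pt_eq h, specFibMap_mk]

theorem spectrumMap_isMorphism : (spectrumMap φ).IsMorphism where
  bijective := φ.isMorphism.bijective
  base_tgt p := p.tgt_pullback φ
  base_src p := p.src_pullback φ
  base_comp {A B C} p q h h' := by
    rw [SpecX.eq_iff_left]
    ext c
    rw [SpecX.rep_comp_left]
    change SpecX.evL _ c = SpecX.evL _ c
    rw [SpecX.evL_pullback, SpecX.evL_pullback, SpecX.evL, SpecX.rep_comp_left, SpecX.evL]
  base_inv {A B} p := by
    rw [SpecX.eq_iff_left]
    ext c
    rw [SpecX.rep_inv_left, SpecX.evR_pullback]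
    refine (SpecX.evL_pullback φ _ c).trans ?_
    rw [SpecX.evL, SpecX.rep_inv_left]
  continuous_base A B := SpecX.continuous_pullback φ
  converging K hK := ⟨_, SpecX.isCompact_preimage_pullback φ hK, fun _ hp => hp⟩
  fibMap_mul {A B C p q} h h' e e' g hg := by
    obtain ⟨x, rfl⟩ := SpecFib.mk_surjective _ e
    obtain ⟨y, rfl⟩ := SpecFib.mk_surjective _ e'
    refine (specFibMap_eq_of_pt_eq φ _ g hg).trans ?_
    rw [φ.isMorphism.map_comp]
    rfl
  fibMap_star {A B p} e g hg := by
    obtain ⟨x, rfl⟩ := SpecFib.mk_surjective _ e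
    refine (specFibMap_eq_of_pt_eq φ _ g hg).trans ?_
    rw [φ.isMorphism.map_star]
    rfl
  fibMap_one {A} p := congrArg (SpecFib.mk p) (φ.isMorphism.map_one A)
  continuous_fibMap A B := continuous_specFibMap φ continuous_induced_dom
  -- The fiber maps are isometric, so δ = ε and L = K suffice.
  vanishing A B ε hε K hK := ⟨ε, hε, K, hK, fun p hp e he =>
    ⟨hp, (norm_specFibMap φ p e).trans_lt he⟩⟩

theorem isC0_pullSection {σ : 𝒞.spectrum.Section A B} (hσ : σ.IsC0) :
    ((spectrumMap φ).pullSection σ).IsC0 := by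
  obtain ⟨x, rfl⟩ := exists_gelfandSection_eq hσ
  exact isC0_gelfandSection (φ.map x)

variable (h𝒞 : 𝒞.spectrum.SectionsClosed) (h𝒟 : 𝒟.spectrum.SectionsClosed)

/-- The naturality square of the Gel'fand transform, true by evaluation on cosets. -/
theorem spectrumMap_Gamma_transform (x : 𝒞.Hom A B) :
    ((spectrumMap φ).Gamma h𝒟 h𝒞 (isC0_pullSection φ)).map (transform h𝒞 x) =
      transform h𝒟 (φ.map x) := rfl

theorem spectrumMap_Gamma_isMorphism :
    ((spectrumMap φ).Gamma h𝒟 h𝒞 (isC0_pullSection φ)).IsMorphism where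
  bijective := φ.isMorphism.bijective
  map_one A := congrArg (transform h𝒟) (φ.isMorphism.map_one A)
  map_comp σ ρ := by
    obtain ⟨x, rfl⟩ := transform_surjective h𝒞 σ
    obtain ⟨y, rfl⟩ := transform_surjective h𝒞 ρ
    rw [← transform_comp, spectrumMap_Gamma_transform, φ.isMorphism.map_comp]
    exact transform_comp h𝒟 _ _
  map_star σ := by
    obtain ⟨x, rfl⟩ := transform_surjective h𝒞 σ
    rw [← transform_star, spectrumMap_Gamma_transform, φ.isMorphism.map_star]
    exact transform_star h𝒟 _
  nondegenerate ω A B := fun ⟨τ, hτ⟩ => by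
    obtain ⟨y, rfl⟩ := transform_surjective h𝒟 τ
    -- Non-degeneracy of φ is applied to ω restricted along the Gel'fand transform of 𝒟.
    obtain ⟨x, hx⟩ := φ.isMorphism.nondegenerate (transformPullback h𝒟 ω) A B ⟨y, hτ⟩
    exact ⟨transform h𝒞 x, hx⟩

end Functoriality

/-- The Gel'fand transform as an isomorphism in the category of small commutative
C*-categories. -/
def gelfandIso (𝒞 : CommCStarCat.{u}) (hΓ : 𝒞.spectrum.SectionsClosed) :
    𝒞 ≅ 𝒞.gammaSpectrum hΓ (gamma_isCommCStarCat hΓ) where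
  hom := ⟨𝒞.gelfand hΓ isC0_gelfandSection, gelfand_isMorphism hΓ⟩
  inv := ⟨inverseTransform hΓ, inverseTransform_isMorphism hΓ⟩
  hom_inv_id := Mor.ext_of_heq rfl fun _ _ x => heq_of_eq (inverseTransform_transform hΓ x)
  inv_hom_id := Mor.ext_of_heq rfl fun _ _ σ => heq_of_eq (transform_inverseTransform hΓ σ)

end CommCStarCat

end

/-! ### The natural isomorphism -/

theorem mainTheorem2 :
    ∃ (_ : ∀ 𝒞 : CommCStarCat.{u}, 𝒞.spectrum.IsSpaceoid)
      (_ : ∀ {𝒞 𝒟 : CommCStarCat.{u}} (φ : 𝒞 ⟶ 𝒟), (CommCStarCat.spectrumMap φ).IsMorphism)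
      (hΓ : ∀ 𝒞 : CommCStarCat.{u}, 𝒞.spectrum.SectionsClosed)
      (hΓC : ∀ 𝒞 : CommCStarCat.{u}, (𝒞.spectrum.Gamma (hΓ 𝒞)).IsCommCStarCat)
      (hmem : ∀ {𝒞 𝒟 : CommCStarCat.{u}} (φ : 𝒞 ⟶ 𝒟) {A B : 𝒞.Obj}
        {σ : 𝒞.spectrum.Section A B},
        σ.IsC0 → ((CommCStarCat.spectrumMap φ).pullSection σ).IsC0)
      (hmor : ∀ {𝒞 𝒟 : CommCStarCat.{u}} (φ : 𝒞 ⟶ 𝒟),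
        ((CommCStarCat.spectrumMap φ).Gamma (hΓ 𝒟) (hΓ 𝒞) (hmem φ)).IsMorphism)
      (hx : ∀ (𝒞 : CommCStarCat.{u}) {A B : 𝒞.Obj} (x : 𝒞.Hom A B),
        SpaceoidData.Section.IsC0 (𝓔 := 𝒞.spectrum) (CommCStarCat.gelfandSection x))
      (hG : ∀ 𝒞 : CommCStarCat.{u}, (𝒞.gelfand (hΓ 𝒞) (hx 𝒞)).IsMorphism)
      (𝔊 : 𝟭 CommCStarCat.{u} ≅ CommCStarCat.gammaSpectrumFunctor hΓ hΓC hmem hmor),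
      (∀ 𝒞 : CommCStarCat.{u}, 𝔊.hom.app 𝒞 = ⟨𝒞.gelfand (hΓ 𝒞) (hx 𝒞), hG 𝒞⟩) ∧
      ∀ 𝒞 : CommCStarCat.{u}, (𝒞.gelfand (hΓ 𝒞) (hx 𝒞)).IsIsometric ∧
        ∀ A B : 𝒞.Obj,
          Function.Bijective (fun x : 𝒞.Hom A B => (𝒞.gelfand (hΓ 𝒞) (hx 𝒞)).map x) := by
  refine ⟨CommCStarCat.spectrum_isSpaceoid, CommCStarCat.spectrumMap_isMorphism,
    CommCStarCat.spectrum_sectionsClosed,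
    fun 𝒞 => CommCStarCat.gamma_isCommCStarCat 𝒞.spectrum_sectionsClosed,
    CommCStarCat.isC0_pullSection,
    fun φ => CommCStarCat.spectrumMap_Gamma_isMorphism φ _ _,
    fun _ {_ _} => CommCStarCat.isC0_gelfandSection,
    fun 𝒞 => CommCStarCat.gelfand_isMorphism 𝒞.spectrum_sectionsClosed,
    NatIso.ofComponents (fun 𝒞 => 𝒞.gelfandIso 𝒞.spectrum_sectionsClosed)
      (fun φ => CommCStarCat.Mor.ext_of_heq rfl fun _ _ _ => HEq.rfl),
    fun _ => rfl, fun 𝒞 => ⟨fun A B x => CommCStarCat.norm_transform _ x, fun A B =>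
      (CommCStarCat.transformEquiv 𝒞.spectrum_sectionsClosed A B).bijective⟩⟩
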